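/- Let $K$ be a number field with ring of integers $\mathcal{O}_K$ and let $p$ be a prime. Let $T=\operatorname{Res}_{K/\mathbb{Q}}\mathbb{G}_m$ be the restriction of scalars, and let $\Gamma\le T(\mathbb{Q})\simeq K^\times$ be the subgroup corresponding to $\mathcal{O}_K^\times$. Write $\operatorname{rk}$ for the rank of an abelian group, and use the following notions. - $T(\mathbb{Q}_p)_f$ is the union of the compact subgroups of the $p$-adic Lie group $T(\mathbb{Q}_p)$, and $\log\colon T(\mathbb{Q}_p)_f\to\operatorname{Lie}T(\mathbb{Q}_p)$ is the canonical logarithm homomorphism. For a finitely generated subgroup $\Delta\le T(\mathbb{Q})$ contained in $T(\mathbb{Q}_p)_f$, the closure $\overline{\log\Delta}$ is a finitely generated $\mathbb{Z}_p$-submodule of $\operatorname{Lie}T(\mathbb{Q}_p)$, and $\dim\overline{\Delta}:=\operatorname{rk}_{\mathbb{Z}_p}\overline{\log\Delta}$ (the dimension of the $p$-adic closure of $\Delta$ in $T(\mathbb{Q}_p)$). - $d(T,\Delta):=\inf_{H\le T}\bigl(\dim H+\operatorname{rk}\Delta-\operatorname{rk}(\Delta\cap H(\mathbb{Q}))\bigr)$,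 the infimum being over all subgroup schemes $H$ of $T$ over $\mathbb{Q}$. - Leopoldt's conjecture for $K$ and $p$ is the assertion that the natural map from $\mathbb{Z}_p\otimes_{\mathbb{Z}}\mathcal{O}_K^\times$ to $\varprojlim_n \mathbb{Z}_p\otimes_{\mathbb{Z}}(\mathcal{O}_K/p^n\mathcal{O}_K)^\times$, the pro-$p$ completion of $\prod_{v\mid p}\mathcal{O}_{K_v}^\times$, is injective. Then $\Gamma$ is finitely generated and contained in $T(\mathbb{Q}_p)_f$, one has $d(T,\Gamma)=\operatorname{rk}\Gamma$, and Leopoldt's conjecture for $K$ and $p$ holds if and only if $\dim\overline{\Gamma}=d(T,\Gamma)$. -/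

import Mathlib

open scoped TensorProduct NumberField Topology
open WithConv

noncomputable section

/-! ## The torus `Res_{B/F} 𝔾ₘ`

For a finite-dimensional commutative algebra `B` over a field `F`, the coordinate ring of
`Res_{B/F} 𝔾ₘ`, the affine `F`-group with `R`-points `(R ⊗[F] B)ˣ`. With a basis `e` of `B`, it is
`F[X_i, Y_i] / (coordinates of (∑ X_i e_i) (∑ Y_i e_i) - 1)`. -/

namespace ResGm

variable (F B : Type*) [Field F] [CommRing B] [Algebra F B] [FiniteDimensional F B]

/-- The polynomial ring `F[X_i, Y_i]`. -/
abbrev Poly : Type _ :=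
  MvPolynomial (Fin (Module.finrank F B) ⊕ Fin (Module.finrank F B)) F

/-- The basis `1 ⊗ e_i` of `R ⊗[F] B` over `R`. -/
abbrev baseBasis (R : Type*) [CommRing R] [Algebra F R] :
    Module.Basis (Fin (Module.finrank F B)) R (R ⊗[F] B) :=
  Algebra.TensorProduct.basis R (Module.finBasis F B)

/-- The generic element `∑ X_i e_i`. -/
def genX : Poly F B ⊗[F] B :=
  ∑ i, (MvPolynomial.X (Sum.inl i) : Poly F B) ⊗ₜ[F] Module.finBasis F B i

/-- The generic element `∑ Y_i e_i`. -/
def genY : Poly F B ⊗[F] B :=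
  ∑ i, (MvPolynomial.X (Sum.inr i) : Poly F B) ⊗ₜ[F] Module.finBasis F B i

/-- The ideal generated by the coordinates of `(∑ X_i e_i) (∑ Y_i e_i) - 1`. -/
def relIdeal : Ideal (Poly F B) :=
  Ideal.span (Set.range fun i => (baseBasis F B (Poly F B)).repr (genX F B * genY F B - 1) i)

end ResGm

/-- The coordinate ring of `Res_{B/F} 𝔾ₘ`. -/
def ResGm (F B : Type*) [Field F] [CommRing B] [Algebra F B] [FiniteDimensional F B] : Type _ :=
  ResGm.Poly F B ⧸ ResGm.relIdeal F B

namespace ResGm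

variable (F B : Type*) [Field F] [CommRing B] [Algebra F B] [FiniteDimensional F B]

instance instCommRing : CommRing (ResGm F B) :=
  inferInstanceAs (CommRing (Poly F B ⧸ relIdeal F B))

instance instAlgebra : Algebra F (ResGm F B) :=
  inferInstanceAs (Algebra F (Poly F B ⧸ relIdeal F B))

/-- The quotient map `F[X_i, Y_i] → F[Res_{B/F} 𝔾ₘ]`. -/
def mk : Poly F B →ₐ[F] ResGm F B := Ideal.Quotient.mkₐ F (relIdeal F B)

variable {F B}

/-- The ring homomorphism `R ⊗ B → S ⊗ B` induced by `f : R → S`. -/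
abbrev mapLeft {R S : Type*} [CommRing R] [Algebra F R] [CommRing S] [Algebra F S]
    (f : R →ₐ[F] S) : R ⊗[F] B →ₐ[F] S ⊗[F] B :=
  Algebra.TensorProduct.map f (AlgHom.id F B)

lemma repr_mapLeft {R S : Type*} [CommRing R] [Algebra F R] [CommRing S] [Algebra F S]
    (f : R →ₐ[F] S) (z : R ⊗[F] B) (i : Fin (Module.finrank F B)) :
    (baseBasis F B S).repr (mapLeft f z) i = f ((baseBasis F B R).repr z i) := by
  induction z with
  | zero => simp
  | add x y hx hy => simp [map_add, hx, hy]
  | tmul r b => simp [baseBasis]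

lemma mapLeft_mapLeft {F B : Type*} [Field F] [CommRing B] [Algebra F B]
    {R S T : Type*} [CommRing R] [Algebra F R] [CommRing S] [Algebra F S]
    [CommRing T] [Algebra F T] (f : R →ₐ[F] S) (g : S →ₐ[F] T) (z : R ⊗[F] B) :
    mapLeft g (mapLeft f z) = mapLeft (g.comp f) z := by
  induction z with
  | zero => simp
  | add x y hx hy => simp only [map_add, hx, hy]
  | tmul r b => simp

lemma repr_genX (i : Fin (Module.finrank F B)) :
    (baseBasis F B (Poly F B)).repr (genX F B) i = MvPolynomial.X (Sum.inl i) := by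
  simp [genX, baseBasis, Finsupp.single_apply]

lemma repr_genY (i : Fin (Module.finrank F B)) :
    (baseBasis F B (Poly F B)).repr (genY F B) i = MvPolynomial.X (Sum.inr i) := by
  simp [genY, baseBasis, Finsupp.single_apply]

lemma mapLeft_mk_rel : mapLeft (mk F B) (genX F B) * mapLeft (mk F B) (genY F B) = 1 := by
  rw [← map_mul, ← sub_eq_zero, ← map_one (mapLeft (B := B) (mk F B)), ← map_sub]
  apply (baseBasis F B (ResGm F B)).repr.injective
  ext i
  rw [repr_mapLeft]
  simp only [map_zero, Finsupp.coe_zero, Pi.zero_apply]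
  exact Ideal.Quotient.eq_zero_iff_mem.mpr (Ideal.subset_span ⟨i, rfl⟩)

variable (F B) in
/-- The universal unit of `F[Res_{B/F} 𝔾ₘ] ⊗ B`. -/
def univ : (ResGm F B ⊗[F] B)ˣ where
  val := mapLeft (mk F B) (genX F B)
  inv := mapLeft (mk F B) (genY F B)
  val_inv := mapLeft_mk_rel
  inv_val := by rw [mul_comm, mapLeft_mk_rel]

section points

variable {R S : Type*} [CommRing R] [Algebra F R] [CommRing S] [Algebra F S]

/-- The unit of `R ⊗ B` corresponding to an `R`-point of `Res_{B/F} 𝔾ₘ`. -/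
def toUnits (f : ResGm F B →ₐ[F] R) : (R ⊗[F] B)ˣ :=
  Units.map (mapLeft (B := B) f : ResGm F B ⊗[F] B →* R ⊗[F] B) (univ F B)

lemma val_toUnits (f : ResGm F B →ₐ[F] R) :
    (toUnits f : R ⊗[F] B) = mapLeft (f.comp (mk F B)) (genX F B) := by
  rw [← mapLeft_mapLeft]; rfl

lemma val_inv_toUnits (f : ResGm F B →ₐ[F] R) :
    ((toUnits f)⁻¹ : (R ⊗[F] B)ˣ) = mapLeft (f.comp (mk F B)) (genY F B) := by
  rw [← mapLeft_mapLeft]; rfl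

lemma toUnits_comp (f : ResGm F B →ₐ[F] R) (g : R →ₐ[F] S) :
    toUnits (g.comp f) = Units.map (mapLeft (B := B) g : R ⊗[F] B →* S ⊗[F] B) (toUnits f) := by
  ext
  change mapLeft (g.comp f) _ = mapLeft g (mapLeft f _)
  rw [mapLeft_mapLeft]

/-- Evaluation of polynomials at the coordinates of `u` and `u⁻¹`. -/
def evalUnit (u : (R ⊗[F] B)ˣ) : Poly F B →ₐ[F] R :=
  MvPolynomial.aeval (Sum.elim (fun i => (baseBasis F B R).repr (u : R ⊗[F] B) i)
    (fun i => (baseBasis F B R).repr ((u⁻¹ : (R ⊗[F] B)ˣ) : R ⊗[F] B) i))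

lemma mapLeft_evalUnit_genX (u : (R ⊗[F] B)ˣ) : mapLeft (evalUnit u) (genX F B) = u := by
  apply (baseBasis F B R).repr.injective
  ext i
  rw [repr_mapLeft, repr_genX]
  simp [evalUnit]

lemma mapLeft_evalUnit_genY (u : (R ⊗[F] B)ˣ) :
    mapLeft (evalUnit u) (genY F B) = ((u⁻¹ : (R ⊗[F] B)ˣ) : R ⊗[F] B) := by
  apply (baseBasis F B R).repr.injective
  ext i
  rw [repr_mapLeft, repr_genY]
  simp [evalUnit]

lemma evalUnit_eq_zero (u : (R ⊗[F] B)ˣ) : ∀ a ∈ relIdeal F B, evalUnit u a = 0 := by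
  intro a ha
  have : relIdeal F B ≤ RingHom.ker (evalUnit u) := by
    rw [relIdeal, Ideal.span_le]
    rintro _ ⟨i, rfl⟩
    rw [SetLike.mem_coe, RingHom.mem_ker, ← repr_mapLeft, map_sub, map_mul, map_one,
      mapLeft_evalUnit_genX, mapLeft_evalUnit_genY, Units.mul_inv, sub_self, map_zero,
      Finsupp.zero_apply]
  exact this ha

/-- The `R`-point of `Res_{B/F} 𝔾ₘ` corresponding to a unit of `R ⊗ B`. -/
def ofUnits (u : (R ⊗[F] B)ˣ) : ResGm F B →ₐ[F] R :=
  Ideal.Quotient.liftₐ (relIdeal F B) (evalUnit u) (evalUnit_eq_zero u)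

lemma ofUnits_comp_mk (u : (R ⊗[F] B)ˣ) : (ofUnits u).comp (mk F B) = evalUnit u := by
  rfl

lemma hom_ext {f g : ResGm F B →ₐ[F] R} (h : f.comp (mk F B) = g.comp (mk F B)) : f = g := by
  ext a
  obtain ⟨a, rfl⟩ := Ideal.Quotient.mk_surjective a
  exact DFunLike.congr_fun h a

/-- The defining property of the Weil restriction: `Res_{B/F} 𝔾ₘ (R) = (R ⊗ B)ˣ`. -/
def pointsEquiv : (ResGm F B →ₐ[F] R) ≃ (R ⊗[F] B)ˣ where
  toFun := toUnits
  invFun := ofUnits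
  left_inv f := by
    apply hom_ext
    rw [ofUnits_comp_mk]
    ext (i | i)
    · simp only [evalUnit, MvPolynomial.aeval_X, Sum.elim_inl]
      rw [val_toUnits, repr_mapLeft, repr_genX]
    · simp only [evalUnit, MvPolynomial.aeval_X, Sum.elim_inr]
      rw [val_inv_toUnits, repr_mapLeft, repr_genY]
  right_inv u := by
    ext
    rw [val_toUnits, ofUnits_comp_mk, mapLeft_evalUnit_genX]

lemma toUnits_injective : Function.Injective (toUnits : (ResGm F B →ₐ[F] R) → (R ⊗[F] B)ˣ) :=
  pointsEquiv.injective

lemma toUnits_ofUnits (u : (R ⊗[F] B)ˣ) : toUnits (ofUnits u) = u :=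
  pointsEquiv.apply_symm_apply u

lemma toUnits_id : toUnits (AlgHom.id F (ResGm F B)) = univ F B := by
  ext
  change mapLeft (AlgHom.id F _) _ = _
  simp [mapLeft]

/-- The map `(R ⊗ B)ˣ → (S ⊗ B)ˣ` induced by `g : R → S`. -/
abbrev unitsMap (g : R →ₐ[F] S) : (R ⊗[F] B)ˣ →* (S ⊗[F] B)ˣ :=
  Units.map (mapLeft (B := B) g : R ⊗[F] B →* S ⊗[F] B)

lemma unitsMap_unitsMap {F B R S T : Type*} [Field F] [CommRing B] [Algebra F B]
    [CommRing R] [Algebra F R] [CommRing S] [Algebra F S] [CommRing T] [Algebra F T] (f : R →ₐ[F] S) (g : S →ₐ[F] T)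
    (u : (R ⊗[F] B)ˣ) : unitsMap g (unitsMap f u) = unitsMap (g.comp f) u := by
  ext
  exact mapLeft_mapLeft f g _

lemma unitsMap_univ (f : ResGm F B →ₐ[F] R) : unitsMap f (univ F B) = toUnits f := rfl

end points

/-! ### The Hopf algebra structure, dual to multiplication of units -/

/-- Comultiplication: the product of the two universal units. -/
def comulHom : ResGm F B →ₐ[F] ResGm F B ⊗[F] ResGm F B :=
  ofUnits (unitsMap Algebra.TensorProduct.includeLeft (univ F B) *
    unitsMap Algebra.TensorProduct.includeRight (univ F B))

/-- Counit: the unit `1`. -/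
def counitHom : ResGm F B →ₐ[F] F := ofUnits 1

/-- Antipode: the inverse of the universal unit. -/
def antipodeHom : ResGm F B →ₐ[F] ResGm F B := ofUnits (univ F B)⁻¹

lemma toUnits_comp_comul {R : Type*} [CommRing R] [Algebra F R]
    (g : ResGm F B ⊗[F] ResGm F B →ₐ[F] R) :
    toUnits (g.comp comulHom) = toUnits (g.comp Algebra.TensorProduct.includeLeft) *
      toUnits (g.comp Algebra.TensorProduct.includeRight) := by
  rw [toUnits_comp, comulHom, toUnits_ofUnits, map_mul]
  rw [← unitsMap_univ, ← unitsMap_univ, ← unitsMap_unitsMap, ← unitsMap_unitsMap]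

lemma toUnits_comp_counit {R : Type*} [CommRing R] [Algebra F R] (g : F →ₐ[F] R) :
    toUnits (g.comp (counitHom (B := B))) = 1 := by
  rw [toUnits_comp, counitHom, toUnits_ofUnits, map_one]

lemma toUnits_comp_antipode {R : Type*} [CommRing R] [Algebra F R] (g : ResGm F B →ₐ[F] R) :
    toUnits (g.comp antipodeHom) = (toUnits g)⁻¹ := by
  rw [toUnits_comp, antipodeHom, toUnits_ofUnits, map_inv]; rfl

lemma comul_coassoc :
    (Algebra.TensorProduct.assoc F F F (ResGm F B) (ResGm F B) (ResGm F B)).toAlgHom.comp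
      ((Algebra.TensorProduct.map comulHom (.id F (ResGm F B))).comp comulHom)
      = (Algebra.TensorProduct.map (.id F (ResGm F B)) comulHom).comp comulHom := by
  apply toUnits_injective
  have h1 : ((Algebra.TensorProduct.assoc F F F (ResGm F B) (ResGm F B) (ResGm F B)).toAlgHom.comp
      (Algebra.TensorProduct.map comulHom (.id F (ResGm F B)))).comp
        Algebra.TensorProduct.includeLeft =
      ((Algebra.TensorProduct.assoc F F F (ResGm F B) (ResGm F B) (ResGm F B)).toAlgHom.comp
        Algebra.TensorProduct.includeLeft).comp comulHom :=
    AlgHom.ext fun a => by simp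
  have h2 : (Algebra.TensorProduct.map (.id F (ResGm F B)) comulHom).comp
        Algebra.TensorProduct.includeRight =
      (Algebra.TensorProduct.includeRight (R := F) (A := ResGm F B)
        (B := ResGm F B ⊗[F] ResGm F B)).comp comulHom :=
    AlgHom.ext fun a => by simp
  rw [← AlgHom.comp_assoc, toUnits_comp_comul, toUnits_comp_comul, h1, h2, toUnits_comp_comul,
    toUnits_comp_comul, mul_assoc]
  congr 2
  · exact AlgHom.ext fun a => by simp [Algebra.TensorProduct.one_def]
  · exact congrArg toUnits (AlgHom.ext fun a => by simp [Algebra.TensorProduct.one_def])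

lemma counit_rTensor :
    (Algebra.TensorProduct.map (counitHom (B := B)) (.id F (ResGm F B))).comp comulHom
      = ((Algebra.TensorProduct.lid F (ResGm F B)).symm : ResGm F B →ₐ[F] _) := by
  apply toUnits_injective
  have h1 : (Algebra.TensorProduct.map (counitHom (B := B)) (.id F (ResGm F B))).comp
        Algebra.TensorProduct.includeLeft =
      (Algebra.TensorProduct.includeLeft (R := F) (S := F) (A := F)
        (B := ResGm F B)).comp (counitHom (B := B)) :=
    AlgHom.ext fun a => by simp
  rw [toUnits_comp_comul, h1, toUnits_comp_counit, one_mul]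
  exact congrArg toUnits (AlgHom.ext fun a => by simp)

lemma counit_lTensor :
    (Algebra.TensorProduct.map (.id F (ResGm F B)) (counitHom (B := B))).comp comulHom
      = ((Algebra.TensorProduct.rid F F (ResGm F B)).symm : ResGm F B →ₐ[F] _) := by
  apply toUnits_injective
  have h1 : (Algebra.TensorProduct.map (.id F (ResGm F B)) (counitHom (B := B))).comp
        Algebra.TensorProduct.includeRight =
      (Algebra.TensorProduct.includeRight (R := F) (A := ResGm F B) (B := F)).comp
        (counitHom (B := B)) :=
    AlgHom.ext fun a => by simp
  rw [toUnits_comp_comul, h1, toUnits_comp_counit, mul_one]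
  exact congrArg toUnits (AlgHom.ext fun a => by simp)

instance instBialgebra : Bialgebra F (ResGm F B) :=
  Bialgebra.ofAlgHom comulHom counitHom comul_coassoc counit_rTensor counit_lTensor

lemma comulAlgHom_eq : Bialgebra.comulAlgHom F (ResGm F B) = comulHom := rfl

lemma counitAlgHom_eq : Bialgebra.counitAlgHom F (ResGm F B) = counitHom := rfl

lemma comp_comul_eq (g : ResGm F B ⊗[F] ResGm F B →ₐ[F] ResGm F B)
    (h : toUnits (g.comp Algebra.TensorProduct.includeLeft) *
      toUnits (g.comp Algebra.TensorProduct.includeRight) = 1) :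
    g.comp (Bialgebra.comulAlgHom F (ResGm F B)) =
      (Algebra.ofId F (ResGm F B)).comp (Bialgebra.counitAlgHom F (ResGm F B)) := by
  apply toUnits_injective
  rw [comulAlgHom_eq, counitAlgHom_eq, toUnits_comp_comul, toUnits_comp_counit, h]

lemma toUnits_antipode : toUnits (antipodeHom (F := F) (B := B)) = (univ F B)⁻¹ :=
  toUnits_ofUnits _

lemma lift_comp_left (f g : ResGm F B →ₐ[F] ResGm F B) (h : ∀ x y, Commute (f x) (g y)) :
    (Algebra.TensorProduct.lift f g h).comp Algebra.TensorProduct.includeLeft = f :=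
  AlgHom.ext fun a => by simp

lemma lift_comp_right (f g : ResGm F B →ₐ[F] ResGm F B) (h : ∀ x y, Commute (f x) (g y)) :
    (Algebra.TensorProduct.lift f g h).comp Algebra.TensorProduct.includeRight = g :=
  AlgHom.ext fun a => by simp

instance instHopfAlgebra : HopfAlgebra F (ResGm F B) :=
  HopfAlgebra.ofAlgHom antipodeHom
    (comp_comul_eq _ <| (congrArg₂ (· * ·) (congrArg toUnits (lift_comp_left _ _ _))
      (congrArg toUnits (lift_comp_right _ _ _))).trans <| by
        simp only [toUnits_antipode, toUnits_id, inv_mul_cancel])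
    (comp_comul_eq _ <| (congrArg₂ (· * ·) (congrArg toUnits (lift_comp_left _ _ _))
      (congrArg toUnits (lift_comp_right _ _ _))).trans <| by
        simp only [toUnits_antipode, toUnits_id, mul_inv_cancel])

instance instIsCocomm : Coalgebra.IsCocomm F (ResGm F B) where
  comm_comp_comul := by
    have h : (Algebra.TensorProduct.comm F (ResGm F B) (ResGm F B)).toAlgHom.comp comulHom =
        comulHom := by
      apply toUnits_injective
      rw [toUnits_comp_comul, mul_comm]
      conv_rhs => rw [← AlgHom.id_comp comulHom, toUnits_comp_comul]
      exact congrArg₂ (· * ·) (congrArg toUnits (AlgHom.ext fun a => by simp))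
        (congrArg toUnits (AlgHom.ext fun a => by simp))
    exact congrArg AlgHom.toLinearMap h

/-- The group isomorphism `Res_{B/F} 𝔾ₘ (R) ≃ (R ⊗ B)ˣ`. -/
def pointsMulEquiv (R : Type*) [CommRing R] [Algebra F R] :
    WithConv (ResGm F B →ₐ[F] R) ≃* (R ⊗[F] B)ˣ where
  toFun f := toUnits f.ofConv
  invFun u := toConv (ofUnits u)
  left_inv f := congrArg toConv (pointsEquiv.symm_apply_apply f.ofConv)
  right_inv u := toUnits_ofUnits u
  map_mul' f g := by
    rw [AlgHom.convMul_def, ofConv_toConv, comulAlgHom_eq, ← AlgHom.comp_assoc,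
      toUnits_comp_comul]
    congr 1
    · exact congrArg toUnits (AlgHom.ext fun a => by simp)
    · exact congrArg toUnits (AlgHom.ext fun a => by simp)

end ResGm

/-! ## Affine commutative algebraic groups over `ℚ`

An affine commutative group scheme `G` of finite type over `ℚ` is given by its coordinate ring `A`,
a commutative and cocommutative Hopf algebra of finite type. Its group of `R`-points is
`WithConv (A →ₐ[ℚ] R)` with convolution as multiplication. -/

namespace AlgGroup

variable (A : Type*) [CommRing A] [HopfAlgebra ℚ A]

/-- The group `G(R)`. -/
abbrev Points (R : Type*) [CommRing R] [Algebra ℚ R] : Type _ := WithConv (A →ₐ[ℚ] R)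

variable {A}

/-- Inversion in `G(R)` is composition with the antipode. -/
instance instGroupPoints {R : Type*} [CommRing R] [Algebra ℚ R] : Group (Points A R) where
  inv g := toConv (g.ofConv.comp (HopfAlgebra.antipodeAlgHom ℚ A))
  inv_mul_cancel g := ofConv_injective <| by
    have h := AlgHom.comp_convMul_distrib g.ofConv
      (toConv (HopfAlgebra.antipodeAlgHom ℚ A)) (toConv (AlgHom.id ℚ A))
    rw [AlgHom.antipode_id_cancel] at h
    refine h.symm.trans (AlgHom.ext fun a => ?_)
    change g.ofConv (algebraMap ℚ A _) = algebraMap ℚ R _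
    simp

instance instCommGroupPoints [Coalgebra.IsCocomm ℚ A] {R : Type*} [CommRing R] [Algebra ℚ R] :
    CommGroup (Points A R) where
  mul_comm := mul_comm

/-- The homomorphism `G(R) → G(S)` induced by `R → S`. -/
def mapPoints {R S : Type*} [CommRing R] [Algebra ℚ R] [CommRing S] [Algebra ℚ S]
    (f : R →ₐ[ℚ] S) : Points A R →* Points A S where
  toFun g := toConv (f.comp g.ofConv)
  map_one' := ofConv_injective <| AlgHom.ext fun a => by
    change f (algebraMap ℚ R _) = algebraMap ℚ S _
    simp
  map_mul' g h := ofConv_injective (AlgHom.comp_convMul_distrib f g h)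

/-- For a closed subgroup scheme `H = Spec (A ⧸ I)` of `G`, where `I` is a Hopf ideal, the
homomorphism `H(R) → G(R)`. -/
def subgroupIncl (I : Ideal A) [I.IsHopfIdeal ℚ] (R : Type*) [CommRing R] [Algebra ℚ R] :
    Points (A ⧸ I) R →* Points A R where
  toFun g := toConv (g.ofConv.comp (Ideal.Quotient.mkₐ ℚ I))
  map_one' := ofConv_injective <| AlgHom.ext fun _ => rfl
  map_mul' g h := ofConv_injective
    (AlgHom.convMul_comp_bialgHom_distrib g h (Bialgebra.Quotient.mkBialgHom I))

/-- `H(R)` as a subgroup of `G(R)`. -/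
def subgroupPoints (I : Ideal A) [I.IsHopfIdeal ℚ] (R : Type*) [CommRing R] [Algebra ℚ R] :
    Subgroup (Points A R) :=
  (subgroupIncl I R).range

lemma mem_subgroupPoints_iff (I : Ideal A) [I.IsHopfIdeal ℚ] (R : Type*) [CommRing R]
    [Algebra ℚ R] (g : Points A R) : g ∈ subgroupPoints I R ↔ ∀ a ∈ I, g.ofConv a = 0 := by
  constructor
  · rintro ⟨h, rfl⟩ a ha
    change h.ofConv (Ideal.Quotient.mk I a) = 0
    rw [Ideal.Quotient.eq_zero_iff_mem.mpr ha, map_zero]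
  · intro hg
    exact ⟨toConv (Ideal.Quotient.liftₐ I g.ofConv hg), ofConv_injective <| AlgHom.ext fun _ => rfl⟩

section rank

variable [Coalgebra.IsCocomm ℚ A]

/-- The rank of an abelian group `Γ ≤ G(R)`. -/
def rk {R : Type*} [CommRing R] [Algebra ℚ R] (Γ : Subgroup (Points A R)) : ℕ :=
  Module.finrank ℤ (Additive Γ)

/-- `d(G, Γ) = inf_H (dim H + rk Γ - rk (Γ ∩ H))`, the infimum being over all (closed) subgroup
schemes `H = Spec (A ⧸ I)` of `G`; here `dim H` is the Krull dimension of `A ⧸ I`. -/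
def d (Γ : Subgroup (Points A ℚ)) : ℕ :=
  sInf {m : ℕ | ∃ (I : Ideal A) (_ : I.IsHopfIdeal ℚ),
    ((m + rk (Γ ⊓ subgroupPoints I ℚ) : ℕ) : WithBot ℕ∞) = ringKrullDim (A ⧸ I) + (rk Γ : ℕ)}

end rank

/-! ### The `p`-adic Lie group `G(ℚ_p)` -/

section padic

variable (p : ℕ) [Fact p.Prime]

/-- The `p`-adic topology on `G(ℚ_p)`: the coarsest one for which all regular functions are
continuous. For generators `a₁, …, aₙ` of `A`, it is the topology of `G(ℚ_p) ⊆ ℚ_pⁿ`. -/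
instance instTopologicalSpacePoints : TopologicalSpace (Points A ℚ_[p]) :=
  .induced (fun g a => g.ofConv a) (inferInstance : TopologicalSpace (A → ℚ_[p]))

variable (A) in
/-- `G(ℚ_p)_f`: the union of the compact subgroups of `G(ℚ_p)`. -/
def compactPart : Set (Points A ℚ_[p]) :=
  {g | ∃ C : Subgroup (Points A ℚ_[p]), IsCompact (C : Set (Points A ℚ_[p])) ∧ g ∈ C}

variable (A) in
/-- `Lie G(ℚ_p)`, the tangent space at the identity: the point derivations `A → ℚ_p` at the counit,
with the topology of pointwise convergence. -/
def LieAlg : Submodule ℚ_[p] (A → ℚ_[p]) where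
  carrier := {D | (∀ a b, D (a + b) = D a + D b) ∧ (∀ (q : ℚ) a, D (q • a) = q • D a) ∧
    ∀ a b, D (a * b) =
      algebraMap ℚ ℚ_[p] (Coalgebra.counit a) * D b + algebraMap ℚ ℚ_[p] (Coalgebra.counit b) * D a}
  add_mem' := by
    rintro D E ⟨h1, h2, h3⟩ ⟨k1, k2, k3⟩
    refine ⟨fun a b => ?_, fun q a => ?_, fun a b => ?_⟩
    · simp only [Pi.add_apply, h1, k1]; ring
    · simp only [Pi.add_apply, h2, k2, smul_add]
    · simp only [Pi.add_apply, h3, k3]; ring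
  zero_mem' := by simp
  smul_mem' := by
    rintro c D ⟨h1, h2, h3⟩
    refine ⟨fun a b => ?_, fun q a => ?_, fun a b => ?_⟩
    · simp only [Pi.smul_apply, h1, smul_add]
    · simp only [Pi.smul_apply, h2]; rw [smul_comm]
    · simp only [Pi.smul_apply, h3, smul_eq_mul]; ring

variable {p}

/-- `D = log g`, for the canonical homomorphism `log : G(ℚ_p)_f → Lie G(ℚ_p)` that is inverse to
the exponential near the identity. Explicitly, `log g` is the derivative at `t = 0` of the `p`-adic
one-parameter group `t ↦ g ^ t`: since `n! → 0` in `ℤ_p`, it is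
`a ↦ lim (a (g ^ n!) - a 1) / n!` for a regular function `a`. The limit exists for
`g ∈ G(ℚ_p)_f`, and for `G = 𝔾ₘ` it gives the usual `p`-adic logarithm on `ℤ_p^×`. -/
def IsLog (g : Points A ℚ_[p]) (D : LieAlg A p) : Prop :=
  ∀ a : A, Filter.Tendsto (fun n : ℕ =>
    ((g ^ n.factorial).ofConv a - algebraMap ℚ ℚ_[p] (Coalgebra.counit a)) / (n.factorial : ℚ_[p]))
    Filter.atTop (𝓝 ((D : A → ℚ_[p]) a))

variable (p)

/-- The homomorphism `G(ℚ) → G(ℚ_p)`. -/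
def toPadic : Points A ℚ →* Points A ℚ_[p] := mapPoints (Algebra.ofId ℚ ℚ_[p])

/-- The set `log Γ ⊆ Lie G(ℚ_p)` for `Γ ≤ G(ℚ)_f`. -/
def logSet (Γ : Subgroup (Points A ℚ)) : Set (LieAlg A p) :=
  {D | ∃ g ∈ Γ, IsLog (toPadic p g) D}

/-- The dimension of the closure of `Γ` in `G(ℚ_p)`: the `ℤ_p`-rank of the closure of `log Γ`
(which is a `ℤ_p`-submodule of `Lie G(ℚ_p)`, so that taking its span changes nothing). -/
def dimClosure (Γ : Subgroup (Points A ℚ)) : ℕ :=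
  Module.finrank ℤ_[p] (Submodule.span ℤ_[p] (closure (logSet p Γ)))

end padic

end AlgGroup

/-! ## Units of number fields -/

section NumberField

variable (K : Type*) [Field K] [NumberField K]

/-- The isomorphism `T(ℚ) ≃ K^×` for `T = Res_{K/ℚ} 𝔾ₘ`. -/
def torusRatPointsEquiv : AlgGroup.Points (ResGm ℚ K) ℚ ≃* Kˣ :=
  (ResGm.pointsMulEquiv ℚ).trans (Units.mapEquiv (Algebra.TensorProduct.lid ℚ K).toMulEquiv)

/-- The subgroup `Γ ≤ T(ℚ)` corresponding to `𝓞_K^× ≤ K^×`. -/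
def unitSubgroup : Subgroup (AlgGroup.Points (ResGm ℚ K) ℚ) :=
  (Units.map (algebraMap (𝓞 K) K : 𝓞 K →* K)).range.comap
    (torusRatPointsEquiv K : AlgGroup.Points (ResGm ℚ K) ℚ →* Kˣ)

/-- Reduction of units `𝓞_K^× → (𝓞_K / p^n)^×`, written additively. -/
def unitReduction (p n : ℕ) :
    Additive (𝓞 K)ˣ →ₗ[ℤ] Additive (𝓞 K ⧸ Ideal.span {(p : 𝓞 K) ^ n})ˣ :=
  (Units.map (Ideal.Quotient.mk (Ideal.span {(p : 𝓞 K) ^ n}) :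
    𝓞 K →* 𝓞 K ⧸ Ideal.span {(p : 𝓞 K) ^ n})).toAdditive.toIntLinearMap

/-- Leopoldt's conjecture for `K` and `p`: the natural map from `ℤ_p ⊗ 𝓞_K^×` to the pro-`p`
completion `lim_n ℤ_p ⊗ (𝓞_K / p^n)^×` of `∏_{v ∣ p} 𝓞_v^× = lim_n (𝓞_K / p^n)^×` is injective. -/
def LeopoldtConjecture (p : ℕ) [Fact p.Prime] : Prop :=
  ∀ x : ℤ_[p] ⊗[ℤ] Additive (𝓞 K)ˣ,
    (∀ n : ℕ, (unitReduction K p n).lTensor ℤ_[p] x = 0) → x = 0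

end NumberField

end

/-!
# Leopoldt's conjecture and the `p`-adic closure of the unit group in `Res_{K/ℚ} 𝔾ₘ`

Write `E = 𝓞_K^×`, `T = Res_{K/ℚ} 𝔾ₘ` and `Γ ≤ T(ℚ)` for the image of `E`.

*The value of `d`.* The trivial subgroup gives `d(T, Γ) ≤ rk Γ`. For equality one needs
`rk (Γ ∩ H) ≤ dim H` for every closed subgroup `H = Spec R` of `T`. Let `Δ ≤ E` correspond to
`Γ ∩ H`. By Dirichlet's theorem the logarithmic embedding maps `Δ` onto a discrete group, so
`rk Δ` is also the real dimension of the span of the image, and `rk Δ` of the functions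
`log |σ|` are linearly independent on `Δ`. The monomials in the corresponding embeddings `σ` are
then distinct characters of `Δ`, so that these `σ` are algebraically independent functions on `Δ`
(`NumberField.Units.exists_embeddings_algebraicIndependent`). They are integral over the image of
`R`, which bounds their number by the Krull dimension of `R` by Noether normalization and going up
(`natCast_card_le_ringKrullDim`).

*The logarithm.* The maximum of the `p`-adic absolute values of the coordinates in an integral basis
is an ultrametric submultiplicative norm on `K`. The binomial expansion shows that
`(1 + w) ^ M - 1 = M (w + O(w ^ 2))`; so `(u ^ n! - 1) / n!` converges for a unit `u`, and
`|m| |log u| = |u ^ m - 1|` as soon as `u ^ m ≡ 1 mod p ^ 2` (`norm_logCoords`). As a point of `T`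
is determined by the coordinates of the unit, even over the dual numbers, this gives a homomorphism
`E → Lie T(ℚ_p)` and a `ℤ_p`-linear map `tensorLog : ℤ_p ⊗ E → Lie T(ℚ_p)`. Its
image is compact, and hence the span of the closure of `log Γ`. By rank-nullity, `dim Γ̄ = rk Γ` if
and only if the kernel of `tensorLog` is torsion.

*Comparison with the Leopoldt map.* Any `x ∈ ℤ_p ⊗ E` is congruent to a unit modulo each power of
`p`. With the norm formula this shows that the kernel of the Leopoldt map lies in that of the
logarithm (`tensorLogCoords_eq_zero`), and that it contains a fixed multiple of the latter
(`lTensor_unitReduction_redOrder_smul_eq_zero`). The Leopoldt map is injective on torsion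
(`eq_zero_of_torsion`), so it is injective if and only if the kernel of the logarithm is torsion.

*Compactness.* Regular functions are bounded on the image of `E` in `T(ℚ_p)`, because
the coordinates of integers are. So the closure of this image is a compact subgroup.
-/

noncomputable section

universe u v

/-! ### Krull dimension and algebraically independent elements -/

/-- Chains of primes lift along injective integral extensions. -/
lemma ringKrullDim_le_of_isIntegral {R S : Type*} [CommRing R] [CommRing S] [Algebra R S]
    [Algebra.IsIntegral R S] (hinj : Function.Injective (algebraMap R S)) :
    ringKrullDim R ≤ ringKrullDim S := by
  refine iSup_le fun l => ?_
  obtain ⟨P, -, hP, hPl⟩ := Ideal.exists_ideal_over_prime_of_isIntegral (S := S)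
    (RelSeries.head l).asIdeal ⊥
    (by rw [← RingHom.ker_eq_comap_bot, (RingHom.injective_iff_ker_eq_bot _).mp hinj]; exact bot_le)
  have : P.LiesOver (RelSeries.head l).asIdeal := ⟨hPl.symm⟩
  obtain ⟨L, hL, -⟩ := Ideal.exists_ltSeries_of_hasGoingUp l P
  rw [← hL]
  exact Order.LTSeries.length_le_krullDim L

/-- Algebraic independence survives modulo some prime: choose one that misses all nonzero
polynomials in the given elements. -/
lemma AlgebraicIndependent.exists_isPrime_quotient {k B ι : Type*} [Field k] [CommRing B]
    [Algebra k B] {x : ι → B} (hx : AlgebraicIndependent k x) :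
    ∃ q : Ideal B, q.IsPrime ∧ AlgebraicIndependent k fun i => Ideal.Quotient.mkₐ k q (x i) := by
  obtain ⟨q, hq, -, hdisj⟩ := Ideal.exists_le_prime_disjoint (⊥ : Ideal B)
    ((nonZeroDivisors (MvPolynomial ι k)).map (MvPolynomial.aeval x : _ →ₐ[k] B)) (by
      rw [Set.disjoint_left]
      rintro _ h0 ⟨f, hf, rfl⟩
      exact nonZeroDivisors.ne_zero hf ((map_eq_zero_iff _ hx).mp h0))
  refine ⟨q, hq, (injective_iff_map_eq_zero _).mpr fun f hf => ?_⟩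
  by_contra hne
  have h : Ideal.Quotient.mkₐ k q (MvPolynomial.aeval x f) = 0 := by
    rw [← hf, ← AlgHom.comp_apply]
    congr 1
    ext i
    simp
  exact Set.disjoint_left.mp hdisj (Ideal.Quotient.eq_zero_iff_mem.mp h)
    ⟨f, mem_nonZeroDivisors_of_ne_zero hne, rfl⟩

/-- A finitely generated algebra `R` over a field has dimension at least the number of algebraically
independent elements in an integral extension that is a domain. -/
lemma natCast_card_le_ringKrullDim_of_isDomain {k R : Type*} {B : Type u} {ι : Type v} [Field k]
    [CommRing R] [Algebra k R] [Algebra.FiniteType k R] [CommRing B] [IsDomain B] [Algebra k B]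
    [Fintype ι]
    (f : R →ₐ[k] B) (hf : f.toRingHom.IsIntegral) {x : ι → B} (hx : AlgebraicIndependent k x) :
    (Fintype.card ι : WithBot ℕ∞) ≤ ringKrullDim R := by
  have hfin : Algebra.FiniteType k f.range :=
    .of_surjective f.rangeRestrict f.rangeRestrict_surjective
  obtain ⟨s, g, hg, hgi⟩ := exists_integral_inj_algHom_of_fg k f.range
  have h1 : (s : WithBot ℕ∞) ≤ ringKrullDim R := by
    refine le_trans ?_ (ringKrullDim_le_of_surjective f.rangeRestrict.toRingHom
      f.rangeRestrict_surjective)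
    let := g.toRingHom.toAlgebra
    have : Algebra.IsIntegral (MvPolynomial (Fin s) k) f.range := ⟨hgi⟩
    refine le_trans ?_ (ringKrullDim_le_of_isIntegral (R := MvPolynomial (Fin s) k) hg)
    simp
  refine le_trans ?_ h1
  let h : MvPolynomial (Fin s) k →ₐ[k] B := f.range.val.comp g
  have hint : h.toRingHom.IsIntegral := by
    refine RingHom.IsIntegral.trans _ _ hgi fun b => ?_
    obtain ⟨P, hP, hPb⟩ := hf b
    refine ⟨P.map f.rangeRestrict.toRingHom, hP.map _, ?_⟩
    rw [Polynomial.eval₂_map]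
    exact hPb
  let y : Fin s → B := fun i => h (MvPolynomial.X i)
  have hh : h = MvPolynomial.aeval y := by
    ext i
    simp [y]
  have halg : Algebra.IsAlgebraic (Algebra.adjoin k (Set.range y)) B := by
    have : Algebra.IsIntegral (Algebra.adjoin k (Set.range y)) B := by
      refine ⟨fun b => ?_⟩
      obtain ⟨P, hP, hPb⟩ := hint b
      have hmem : ∀ a, h a ∈ Algebra.adjoin k (Set.range y) := fun a => by
        rw [Algebra.adjoin_range_eq_range_aeval, hh]
        exact ⟨a, rfl⟩
      refine ⟨P.map (h.codRestrict _ hmem).toRingHom, hP.map _, ?_⟩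
      rw [Polynomial.eval₂_map]
      exact hPb
    infer_instance
  have h2 := Algebra.IsAlgebraic.trdeg_le_cardinalMk k (Set.range y)
  have h3 := hx.lift_cardinalMk_le_trdeg
  have h4 : Cardinal.mk (Set.range y) ≤ s := by
    simpa using Cardinal.mk_range_le_lift (f := y)
  have h5 : (Fintype.card ι : Cardinal.{max u v}) ≤ s := by
    simpa using h3.trans (Cardinal.lift_le.mpr (h2.trans h4))
  exact_mod_cast h5

/-- A finitely generated algebra `R` over a field has dimension at least the number of algebraically
independent elements in any `R`-algebra that are integral over `R`. -/
theorem natCast_card_le_ringKrullDim {k R B ι : Type*} [Field k] [CommRing R]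
    [Algebra k R] [Algebra.FiniteType k R] [CommRing B] [Algebra k B] [Fintype ι]
    (f : R →ₐ[k] B) {x : ι → B} (hint : ∀ i, f.toRingHom.IsIntegralElem (x i))
    (hx : AlgebraicIndependent k x) :
    (Fintype.card ι : WithBot ℕ∞) ≤ ringKrullDim R := by
  let := f.toRingHom.toAlgebra
  have : IsScalarTower k R B := .of_algebraMap_eq fun a => (f.commutes a).symm
  let C : Subalgebra k B := (integralClosure R B).restrictScalars k
  let y : ι → C := fun i => ⟨x i, hint i⟩
  have hy : AlgebraicIndependent k y := .of_comp C.val hx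
  obtain ⟨q, hq, hyq⟩ := hy.exists_isPrime_quotient
  let g : R →ₐ[k] C := f.codRestrict C fun r => isIntegral_algebraMap
  refine natCast_card_le_ringKrullDim_of_isDomain ((Ideal.Quotient.mkₐ k q).comp g)
    (RingHom.IsIntegral.trans g.toRingHom _ ?_
      (RingHom.isIntegral_of_surjective _ (Ideal.Quotient.mkₐ_surjective k q))) hyq
  exact fun b => (integralClosure.isIntegral (R := R) (A := B) b : IsIntegral R _)

/-- Monoid homomorphisms to a field all of whose monomials are distinct are algebraically
independent as functions, by the linear independence of characters. -/
lemma algebraicIndependent_of_injective_prod_pow {k L G ι : Type*} [Field k] [Field L]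
    [Algebra k L] [Monoid G] [Fintype ι] (χ : ι → G →* L)
    (h : ∀ n m : ι → ℕ, (∀ g, ∏ i, χ i g ^ n i = ∏ i, χ i g ^ m i) → n = m) :
    AlgebraicIndependent k fun i => (χ i : G → L) := by
  have hli : LinearIndependent k fun n : ι →₀ ℕ => ((∏ i, χ i ^ n i : G →* L) : G → L) := by
    refine LinearIndependent.restrict_scalars' (K := L) k
      ((linearIndependent_monoidHom G L).comp (fun n : ι →₀ ℕ => ∏ i, χ i ^ n i) ?_)
    intro n m hnm
    refine DFunLike.coe_injective (h n m fun g => ?_)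
    simpa using DFunLike.congr_fun hnm g
  have hcomp :
      (MvPolynomial.aeval fun i => (χ i : G → L) : MvPolynomial ι k →ₐ[k] G → L).toLinearMap =
      Finsupp.linearCombination k (fun n : ι →₀ ℕ => ((∏ i, χ i ^ n i : G →* L) : G → L)) ∘ₗ
        (MvPolynomial.basisMonomials ι k).repr.toLinearMap := by
    refine (MvPolynomial.basisMonomials ι k).ext fun n => ?_
    rw [LinearMap.comp_apply, LinearEquiv.coe_coe, Module.Basis.repr_self,
      Finsupp.linearCombination_single, one_smul, MvPolynomial.coe_basisMonomials,
      AlgHom.toLinearMap_apply, MvPolynomial.aeval_monomial, map_one, one_mul,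
      Finsupp.prod_fintype _ _ (by simp)]
    ext g
    simp
  rw [AlgebraicIndependent, ← AlgHom.coe_toLinearMap, hcomp, LinearMap.coe_comp]
  exact Function.Injective.comp hli (LinearEquiv.injective _)

/-! ### Ranks of groups of units -/

/-- On a subspace of `ι → ℝ` of dimension `r`, some `r` of the coordinates are linearly
independent. -/
lemma Submodule.exists_linearIndependent_coords {ι : Type*} [Fintype ι] (W : Submodule ℝ (ι → ℝ))
    {r : ℕ} (hr : Module.finrank ℝ W = r) :
    ∃ j : Fin r → ι, ∀ n : Fin r → ℝ, (∀ v ∈ W, ∑ i, n i * v (j i) = 0) → n = 0 := by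
  let c : ι → Module.Dual ℝ W := fun i => (LinearMap.proj i).comp W.subtype
  have htop : Submodule.span ℝ (Set.range c) = ⊤ := by
    rw [← Subspace.dualCoannihilator_dualAnnihilator_eq (W := Submodule.span ℝ (Set.range c)),
      show (Submodule.span ℝ (Set.range c)).dualCoannihilator = ⊥ from ?_,
      Submodule.dualAnnihilator_bot]
    refine (Submodule.eq_bot_iff _).mpr fun v hv => Subtype.ext (funext fun i => ?_)
    exact (Submodule.mem_dualCoannihilator _).mp hv (c i) (Submodule.subset_span ⟨i, rfl⟩)
  have key := Submodule.exists_fun_fin_finrank_span_eq ℝ (Set.range c)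
  rw [htop, finrank_top, Subspace.dual_finrank_eq, hr] at key
  obtain ⟨f, hf, -, hli⟩ := key
  choose j hj using hf
  refine ⟨j, fun n hn => funext fun i => ?_⟩
  refine Fintype.linearIndependent_iff.mp hli n (LinearMap.ext fun v => ?_) i
  rw [LinearMap.zero_apply, ← hn v v.2]
  simp [← hj, c]

namespace NumberField.Units

variable {K : Type*} [Field K] [NumberField K]

open dirichletUnitTheorem in
/-- The image of a group of units under the logarithmic embedding spans a real vector space of
dimension the rank of the group, because this image is discrete. -/
lemma finrank_span_image_logEmbedding (Δ : Subgroup (𝓞 K)ˣ) :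
    Module.finrank ℝ
        (Submodule.span ℝ (logEmbedding K '' (Δ.toAddSubgroup : Set (Additive (𝓞 K)ˣ)))) =
      Module.finrank ℤ (Additive Δ) := by
  classical
  let ι : Additive Δ →ₗ[ℤ] Additive (𝓞 K)ˣ := Δ.subtype.toAdditive.toIntLinearMap
  have : Module.Finite ℤ (Additive Δ) := Module.Finite.of_injective ι Subtype.val_injective
  let f : Additive Δ →ₗ[ℤ] logSpace K := (logEmbedding K).toIntLinearMap.comp ι
  have himage : logEmbedding K '' (Δ.toAddSubgroup : Set (Additive (𝓞 K)ˣ)) =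
      (LinearMap.range f : Set (logSpace K)) := by
    ext v
    constructor
    · rintro ⟨x, hx, rfl⟩
      exact ⟨Additive.ofMul ⟨x.toMul, hx⟩, rfl⟩
    · rintro ⟨x, rfl⟩
      exact ⟨ι x, x.toMul.2, rfl⟩
  have hspan : Submodule.span ℤ (logEmbedding K '' (Δ.toAddSubgroup : Set (Additive (𝓞 K)ˣ))) =
      LinearMap.range f := by
    rw [himage, Submodule.span_eq]
  have hdisc : DiscreteTopology (Submodule.span ℤ
      (logEmbedding K '' (Δ.toAddSubgroup : Set (Additive (𝓞 K)ˣ)))) := by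
    rw [← SetLike.isDiscrete_iff_discreteTopology]
    refine (inferInstance : DiscreteTopology (unitLattice K)).isDiscrete.mono ?_
    rw [SetLike.coe_subset_coe, Submodule.span_le]
    rintro _ ⟨i, -, rfl⟩
    exact ⟨i, Submodule.mem_top, rfl⟩
  have hker : Module.finrank ℤ (LinearMap.ker f) = 0 := by
    rw [Module.finrank_eq_zero_iff_isTorsion]
    rintro ⟨x, hx⟩
    have hx' : ((x.toMul : Δ) : (𝓞 K)ˣ) ∈ torsion K := logEmbedding_eq_zero_iff.mp hx
    obtain ⟨n, hn, hxn⟩ := isOfFinOrder_iff_pow_eq_one.mp ((CommGroup.mem_torsion _).mp hx')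
    refine ⟨⟨n, mem_nonZeroDivisors_of_ne_zero (by positivity)⟩, Subtype.ext ?_⟩
    change (n : ℤ) • x = 0
    rw [natCast_zsmul]
    exact congrArg Additive.ofMul (Subtype.ext hxn : x.toMul ^ n = 1)
  have h := (LinearMap.ker f).finrank_quotient_add_finrank
  rw [hker, add_zero, f.quotKerEquivRange.finrank_eq, ← hspan] at h
  rw [← h, ← Set.finrank, ← Set.finrank]
  exact Real.finrank_eq_int_finrank_of_discrete hdisc

/-- On a group of units of rank `r`, some `r` logarithmic absolute values are linearly
independent. -/
lemma exists_infinitePlaces_linearIndependent (Δ : Subgroup (𝓞 K)ˣ) :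
    ∃ w : Fin (Module.finrank ℤ (Additive Δ)) → InfinitePlace K, ∀ n : Fin _ → ℝ,
      (∀ δ ∈ Δ, ∑ i, n i * Real.log (w i (δ : K)) = 0) → n = 0 := by
  classical
  obtain ⟨j, hj⟩ := Submodule.exists_linearIndependent_coords _ (finrank_span_image_logEmbedding Δ)
  refine ⟨fun i => j i, fun n hn => ?_⟩
  have hmult : ∀ i, ((j i : InfinitePlace K).mult : ℝ) ≠ 0 := fun i =>
    Nat.cast_ne_zero.mpr InfinitePlace.mult_pos.ne'
  suffices h : (fun i => n i / (j i : InfinitePlace K).mult) = 0 by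
    funext i
    exact (div_eq_zero_iff.mp (congrFun h i)).resolve_right (hmult i)
  refine hj _ fun v hv => ?_
  induction hv using Submodule.span_induction with
  | mem v hv =>
    obtain ⟨x, hx, rfl⟩ := hv
    rw [← hn x.toMul hx]
    refine Finset.sum_congr rfl fun i _ => ?_
    rw [← ofMul_toMul x, dirichletUnitTheorem.logEmbedding_component, ← mul_assoc,
      div_mul_cancel₀ _ (hmult i)]
    rfl
  | zero => simp
  | add v w _ _ hv hw => simp [mul_add, Finset.sum_add_distrib, hv, hw]
  | smul a v _ hv => simp [mul_left_comm, ← Finset.mul_sum, hv]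

/-- On a group of units of rank `r`, some `r` complex embeddings are algebraically independent as
functions. -/
lemma exists_embeddings_algebraicIndependent (Δ : Subgroup (𝓞 K)ˣ) :
    ∃ σ : Fin (Module.finrank ℤ (Additive Δ)) → K →+* ℂ,
      AlgebraicIndependent ℚ fun i => fun δ : Δ => σ i ((δ : (𝓞 K)ˣ) : K) := by
  obtain ⟨w, hw⟩ := exists_infinitePlaces_linearIndependent Δ
  let coe : Δ →* K := (Units.coeHom K).comp
    ((Units.map (algebraMap (𝓞 K) K : 𝓞 K →* K)).comp Δ.subtype)
  refine ⟨fun i => (w i).embedding, algebraicIndependent_of_injective_prod_pow (G := Δ)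
    (fun i => ((w i).embedding : K →* ℂ).comp coe) fun n m h => ?_⟩
  have hlog : ∀ δ ∈ Δ, ∑ i, ((n i : ℝ) - m i) * Real.log (w i (δ : K)) = 0 := fun δ hδ => by
    have hne : ∀ (k : Fin _ → ℕ), ∀ i ∈ Finset.univ, w i (δ : K) ^ k i ≠ 0 := fun k i _ =>
      pow_ne_zero _ ((w i).pos_iff.mpr (coe_ne_zero δ)).ne'
    have := congrArg (fun z : ℂ => Real.log ‖z‖) (h ⟨δ, hδ⟩)
    simp only [norm_prod, norm_pow] at this
    have hnorm : ∀ i, ‖((w i).embedding : K →* ℂ).comp coe ⟨δ, hδ⟩‖ = w i (δ : K) := fun i =>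
      InfinitePlace.norm_embedding_eq _ _
    simp only [hnorm] at this
    rw [Real.log_prod (hne n), Real.log_prod (hne m)] at this
    simp only [Real.log_pow] at this
    simp only [sub_mul, Finset.sum_sub_distrib, this, sub_self]
  funext i
  exact_mod_cast sub_eq_zero.mp (congrFun (hw _ hlog) i)

end NumberField.Units

/-! ### The trivial subgroup scheme -/

namespace AlgGroup

variable (A : Type*) [CommRing A] [HopfAlgebra ℚ A]

/-- The augmentation ideal, which defines the trivial subgroup scheme. -/
def augIdeal : Ideal A := RingHom.ker (Bialgebra.counitAlgHom ℚ A)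

variable {A} in
lemma mem_augIdeal {a : A} : a ∈ augIdeal A ↔ Coalgebra.counit (R := ℚ) a = 0 := Iff.rfl

instance isHopfIdeal_augIdeal : (augIdeal A).IsHopfIdeal ℚ where
  counit_eq_zero {x} hx := hx
  map_mkQ_comul_eq_zero {x} hx := by
    let I := (augIdeal A).restrictScalars ℚ
    -- modulo the augmentation ideal, every function is the constant given by its counit
    have hmk : I.mkQ = (LinearMap.toSpanSingleton ℚ (A ⧸ I) (I.mkQ 1)).comp Coalgebra.counit := by
      ext a
      rw [LinearMap.comp_apply, LinearMap.toSpanSingleton_apply, ← map_smul, ← sub_eq_zero,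
        ← map_sub, Submodule.mkQ_apply, Submodule.Quotient.mk_eq_zero]
      change Coalgebra.counit (R := ℚ) _ = 0
      simp
    have hcc : TensorProduct.map (Coalgebra.counit (R := ℚ) (A := A)) Coalgebra.counit
        (Coalgebra.comul x) = 0 := by
      rw [← LinearMap.lTensor_comp_rTensor, LinearMap.comp_apply,
        Coalgebra.rTensor_counit_comul, LinearMap.lTensor_tmul,
        show Coalgebra.counit (R := ℚ) x = 0 from hx, TensorProduct.tmul_zero]
    change TensorProduct.map I.mkQ I.mkQ _ = 0
    rw [hmk, TensorProduct.map_comp, LinearMap.comp_apply, hcc, map_zero]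
  antipode_mem x hx := by
    rw [mem_augIdeal] at hx ⊢
    rw [HopfAlgebra.counit_antipode, hx]

lemma ringKrullDim_quotient_augIdeal : ringKrullDim (A ⧸ augIdeal A) = 0 := by
  have hs : Function.Surjective (Bialgebra.counitAlgHom ℚ A) := fun q =>
    ⟨algebraMap ℚ A q, by simp⟩
  exact (ringKrullDim_eq_of_ringEquiv (RingHom.quotientKerEquivOfSurjective
    (f := (Bialgebra.counitAlgHom ℚ A : A →+* ℚ)) hs)).trans (ringKrullDim_eq_zero_of_field ℚ)

lemma subgroupPoints_augIdeal : subgroupPoints (augIdeal A) ℚ = ⊥ := by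
  refine (Subgroup.eq_bot_iff_forall _).mpr fun g hg => ofConv_injective <| AlgHom.ext fun a => ?_
  have h := (mem_subgroupPoints_iff _ _ g).mp hg (a - algebraMap ℚ A (Coalgebra.counit a)) (by
    rw [mem_augIdeal]; simp)
  rw [map_sub, sub_eq_zero] at h
  rw [h, AlgHom.commutes]
  rfl

variable {A} [Coalgebra.IsCocomm ℚ A]

lemma rk_bot {R : Type*} [CommRing R] [Algebra ℚ R] : rk (⊥ : Subgroup (Points A R)) = 0 :=
  Module.finrank_zero_of_subsingleton

/-- If `rk (Γ ∩ H) ≤ dim H` for all `H`, then the infimum defining `d` is attained at `H = 1`. -/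
lemma d_eq_rk (Γ : Subgroup (Points A ℚ))
    (h : ∀ (I : Ideal A) [I.IsHopfIdeal ℚ],
      (rk (Γ ⊓ subgroupPoints I ℚ) : WithBot ℕ∞) ≤ ringKrullDim (A ⧸ I)) :
    d Γ = rk Γ := by
  refine le_antisymm (Nat.sInf_le ⟨augIdeal A, inferInstance, ?_⟩) (le_csInf ?_ ?_)
  · rw [subgroupPoints_augIdeal, inf_bot_eq, rk_bot, ringKrullDim_quotient_augIdeal, add_zero,
      zero_add]
  · refine ⟨rk Γ, augIdeal A, inferInstance, ?_⟩
    rw [subgroupPoints_augIdeal, inf_bot_eq, rk_bot, ringKrullDim_quotient_augIdeal, add_zero,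
      zero_add]
  · rintro m ⟨I, hI, hm⟩
    have h2 : ((rk (Γ ⊓ subgroupPoints I ℚ) + rk Γ : ℕ) : WithBot ℕ∞) ≤
        ((m + rk (Γ ⊓ subgroupPoints I ℚ) : ℕ) : WithBot ℕ∞) := by
      rw [hm, Nat.cast_add]
      exact add_le_add_left (h I) _
    have h3 := Nat.cast_le.mp h2
    omega

end AlgGroup

/-! ### Units as rational points of the torus -/

namespace ResGm

variable {F B : Type*} [Field F] [CommRing B] [Algebra F B] [FiniteDimensional F B]

instance instFiniteType : Algebra.FiniteType F (ResGm F B) :=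
  .of_surjective (mk F B) Ideal.Quotient.mk_surjective

variable (F B) in
/-- The `i`-th coordinate of a unit. -/
def coordX (i : Fin (Module.finrank F B)) : ResGm F B := mk F B (MvPolynomial.X (Sum.inl i))

variable (F B) in
/-- The `i`-th coordinate of the inverse of a unit. -/
def coordY (i : Fin (Module.finrank F B)) : ResGm F B := mk F B (MvPolynomial.X (Sum.inr i))

/-- The coordinates generate the coordinate ring. -/
lemma adjoin_coords :
    Algebra.adjoin F (Set.range (coordX F B) ∪ Set.range (coordY F B)) = ⊤ := by
  rw [← (AlgHom.range_eq_top (mk F B)).mpr Ideal.Quotient.mk_surjective, ← Algebra.map_top,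
    ← MvPolynomial.adjoin_range_X, AlgHom.map_adjoin, ← Set.range_comp]
  congr 1
  ext a
  simp [coordX, coordY]

end ResGm

section units

variable {K : Type*} [Field K] [NumberField K]

variable (K) in
/-- The homomorphism `𝓞_K^× → T(ℚ)`. -/
def unitPoint : (𝓞 K)ˣ →* AlgGroup.Points (ResGm ℚ K) ℚ :=
  ((torusRatPointsEquiv K).symm : Kˣ →* _).comp (Units.map (algebraMap (𝓞 K) K : 𝓞 K →* K))

lemma range_unitPoint : (unitPoint K).range = unitSubgroup K := by
  ext g
  constructor
  · rintro ⟨u, rfl⟩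
    exact ⟨u, by simp [unitPoint]⟩
  · rintro ⟨u, hu⟩
    refine ⟨u, ?_⟩
    simp only [unitPoint, MonoidHom.comp_apply]
    rw [hu]
    exact (torusRatPointsEquiv K).symm_apply_apply g

lemma unitPoint_mem (u : (𝓞 K)ˣ) : unitPoint K u ∈ unitSubgroup K :=
  range_unitPoint (K := K) ▸ ⟨u, rfl⟩

lemma unitPoint_injective : Function.Injective (unitPoint K) :=
  (torusRatPointsEquiv K).symm.injective.comp
    (Units.map_injective (FaithfulSMul.algebraMap_injective (𝓞 K) K))

lemma unitPoint_coordX (u : (𝓞 K)ˣ) (i : Fin (Module.finrank ℚ K)) :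
    (unitPoint K u).ofConv (ResGm.coordX ℚ K i) = (Module.finBasis ℚ K).repr (u : K) i := by
  change ResGm.evalUnit _ _ = _
  simp only [ResGm.evalUnit, MvPolynomial.aeval_X, Sum.elim_inl]
  change (ResGm.baseBasis ℚ K ℚ).repr ((Algebra.TensorProduct.lid ℚ K).symm (u : K)) i = _
  simp [ResGm.baseBasis]

lemma unitPoint_coordY (u : (𝓞 K)ˣ) (i : Fin (Module.finrank ℚ K)) :
    (unitPoint K u).ofConv (ResGm.coordY ℚ K i) =
      (Module.finBasis ℚ K).repr ((u⁻¹ : (𝓞 K)ˣ) : K) i := by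
  change ResGm.evalUnit _ _ = _
  simp only [ResGm.evalUnit, MvPolynomial.aeval_X, Sum.elim_inr]
  change (ResGm.baseBasis ℚ K ℚ).repr ((Algebra.TensorProduct.lid ℚ K).symm
    (((Units.map (algebraMap (𝓞 K) K : 𝓞 K →* K) u)⁻¹ : Kˣ) : K)) i = _
  rw [← map_inv]
  simp [ResGm.baseBasis]

/-- The rank of the group of units in a subgroup scheme of the torus is at most the dimension: the
embeddings of `K` are integral over the regular functions, and as many of them as the rank are
algebraically independent on the group. -/
lemma rk_unitSubgroup_inf_le_ringKrullDim (I : Ideal (ResGm ℚ K)) [I.IsHopfIdeal ℚ] :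
    (AlgGroup.rk (unitSubgroup K ⊓ AlgGroup.subgroupPoints I ℚ) : WithBot ℕ∞) ≤
      ringKrullDim (ResGm ℚ K ⧸ I) := by
  let Δ : Subgroup (𝓞 K)ˣ := (AlgGroup.subgroupPoints I ℚ).comap (unitPoint K)
  have hmap : Δ.map (unitPoint K) = unitSubgroup K ⊓ AlgGroup.subgroupPoints I ℚ := by
    rw [Subgroup.map_comap_eq, range_unitPoint]
  have hrk : AlgGroup.rk (unitSubgroup K ⊓ AlgGroup.subgroupPoints I ℚ) =
      Module.finrank ℤ (Additive Δ) := by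
    rw [← hmap]
    exact (Δ.equivMapOfInjective _ unitPoint_injective).toAdditive.toIntLinearEquiv.finrank_eq.symm
  obtain ⟨σ, hσ⟩ := NumberField.Units.exists_embeddings_algebraicIndependent Δ
  -- restriction of regular functions from `H` to `Δ`
  let f : ResGm ℚ K ⧸ I →ₐ[ℚ] Δ → ℂ := AlgHom.pi fun δ =>
    (Algebra.ofId ℚ ℂ).comp (Ideal.Quotient.liftₐ I (unitPoint K δ).ofConv
      ((AlgGroup.mem_subgroupPoints_iff I ℚ _).mp δ.2))
  have hint : ∀ i, f.toRingHom.IsIntegralElem fun δ : Δ => σ i ((δ : (𝓞 K)ˣ) : K) := by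
    intro i
    let := f.toRingHom.toAlgebra
    have : IsScalarTower ℚ (ResGm ℚ K ⧸ I) (Δ → ℂ) :=
      .of_algebraMap_eq fun a => (f.commutes a).symm
    have hsum : (fun δ : Δ => σ i ((δ : (𝓞 K)ˣ) : K)) =
        ∑ j, f (Ideal.Quotient.mk I (ResGm.coordX ℚ K j)) *
          fun _ => σ i (Module.finBasis ℚ K j) := by
      ext δ
      conv_lhs => rw [← (Module.finBasis ℚ K).sum_repr ((δ : (𝓞 K)ˣ) : K)]
      rw [map_sum, Finset.sum_apply]
      refine Finset.sum_congr rfl fun j _ => ?_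
      rw [Pi.mul_apply, Algebra.smul_def, map_mul, ← unitPoint_coordX]
      congr 1
      exact RingHom.congr_fun
        (Subsingleton.elim ((σ i).comp (algebraMap ℚ K)) (algebraMap ℚ ℂ)) _
    change IsIntegral (ResGm ℚ K ⧸ I) _
    rw [hsum]
    refine IsIntegral.sum _ fun j _ => IsIntegral.mul isIntegral_algebraMap ?_
    refine IsIntegral.tower_top (R := ℚ) ?_
    exact ((Algebra.IsIntegral.isIntegral (R := ℚ) (Module.finBasis ℚ K j)).map
      (σ i).toRatAlgHom).map (Pi.constAlgHom ℚ Δ ℂ)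
  rw [hrk]
  simpa using natCast_card_le_ringKrullDim f hint hσ

lemma d_unitSubgroup : AlgGroup.d (unitSubgroup K) = AlgGroup.rk (unitSubgroup K) :=
  AlgGroup.d_eq_rk _ fun I _ => rk_unitSubgroup_inf_le_ringKrullDim I

lemma unitSubgroup_fg : (unitSubgroup K).FG := by
  rw [← range_unitPoint]
  have : Group.FG (𝓞 K)ˣ := Group.fg_iff_monoid_fg.mpr inferInstance
  exact (Group.fg_iff_subgroup_fg _).mp (Group.fg_range (unitPoint K))

end units

/-! ### The `p`-adic norm on a number field given by an integral basis -/

section padicNorm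

variable (p : ℕ) [hp : Fact p.Prime]

lemma Padic.norm_natCast_inv_le (n : ℕ) : ‖((n : ℚ_[p]))⁻¹‖ ≤ n := by
  rcases eq_or_ne n 0 with rfl | hn
  · simp
  have hp1 : (1 : ℝ) < p := by exact_mod_cast hp.out.one_lt
  rw [norm_inv, ← Rat.cast_natCast, Padic.eq_padicNorm,
    padicNorm.eq_zpow_of_nonzero (Nat.cast_ne_zero.mpr hn), padicValRat.of_nat, ← Rat.cast_inv,
    zpow_neg, inv_inv, zpow_natCast]
  exact_mod_cast Nat.le_of_dvd (Nat.pos_of_ne_zero hn) pow_padicValNat_dvd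

lemma Padic.norm_natCast_le_one (n : ℕ) : ‖(n : ℚ_[p])‖ ≤ 1 := by
  simpa using Padic.norm_int_le_one (p := p) n

lemma Padic.tendsto_factorial :
    Filter.Tendsto (fun n : ℕ => (n.factorial : ℚ_[p])) Filter.atTop (𝓝 0) := by
  have hp1 : (1 : ℝ) < p := by exact_mod_cast hp.out.one_lt
  rw [tendsto_zero_iff_norm_tendsto_zero, Metric.tendsto_atTop]
  intro ε hε
  obtain ⟨k, hk⟩ := exists_pow_lt_of_lt_one hε (inv_lt_one_of_one_lt₀ hp1)
  refine ⟨p ^ k, fun n hn => ?_⟩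
  rw [Real.dist_eq, sub_zero, abs_of_nonneg (norm_nonneg _)]
  refine lt_of_le_of_lt ?_ hk
  have h := (Padic.norm_int_le_pow_iff_dvd (p := p) n.factorial k).mpr (by
    exact_mod_cast Nat.dvd_factorial (pow_pos hp.out.pos k) hn)
  simpa using h

variable {K : Type*} [Field K] [NumberField K]

/-- The coordinates of an element of `K` in an integral basis, as `p`-adic numbers. The maximum norm
of the coordinates is a `p`-adic norm on `K` whose unit ball contains `𝓞_K`. -/
def padicCoords : K →ₗ[ℚ] (Module.Free.ChooseBasisIndex ℤ (𝓞 K) → ℚ_[p]) where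
  toFun z i := ((NumberField.integralBasis K).repr z i : ℚ)
  map_add' x y := by ext i; simp
  map_smul' q x := by
    ext i
    rw [map_smul, Finsupp.smul_apply, smul_eq_mul, Rat.cast_mul, RingHom.id_apply, Pi.smul_apply,
      Rat.smul_def]

lemma padicCoords_apply (z : K) (i) :
    padicCoords p z i = ((NumberField.integralBasis K).repr z i : ℚ) := rfl

lemma padicCoords_injective : Function.Injective (padicCoords p (K := K)) := fun x y h =>
  (NumberField.integralBasis K).repr.injective (Finsupp.ext fun i => by
    simpa [padicCoords_apply] using congrFun h i)

lemma norm_padicCoords_smul (q : ℚ) (z : K) :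
    ‖padicCoords p (q • z)‖ = ‖(q : ℚ_[p])‖ * ‖padicCoords p z‖ := by
  rw [map_smul, ← norm_smul]
  congr 1

lemma padicCoords_div_natCast (z : K) (n : ℕ) :
    padicCoords p (z / n) = (n : ℚ_[p])⁻¹ • padicCoords p z := by
  have : z / n = (n : ℚ)⁻¹ • z := by
    rw [Algebra.smul_def, map_inv₀, map_natCast, div_eq_inv_mul]
  rw [this, map_smul]
  ext i
  simp [Algebra.smul_def]

lemma norm_padicCoords_div_natCast (z : K) (n : ℕ) :
    ‖padicCoords p (z / n)‖ = ‖(n : ℚ_[p])‖⁻¹ * ‖padicCoords p z‖ := by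
  rw [padicCoords_div_natCast, norm_smul, norm_inv]

lemma padicCoords_coe (x : 𝓞 K) (i) :
    padicCoords p (x : K) i = ((NumberField.RingOfIntegers.basis K).repr x i : ℤ) := by
  rw [padicCoords_apply, NumberField.integralBasis_repr_apply]
  simp

lemma norm_padicCoords_coe_le_one (x : 𝓞 K) : ‖padicCoords p (x : K)‖ ≤ 1 :=
  (pi_norm_le_iff_of_nonneg zero_le_one).mpr fun i => by
    rw [padicCoords_coe]; exact Padic.norm_int_le_one _

/-- The elements of `𝓞_K` of norm at most `p ^ (-n)` are the multiples of `p ^ n`. -/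
lemma norm_padicCoords_coe_le_pow_iff (x : 𝓞 K) (n : ℕ) :
    ‖padicCoords p (x : K)‖ ≤ (p : ℝ) ^ (-n : ℤ) ↔ (p : 𝓞 K) ^ n ∣ x := by
  have hp0 : (0 : ℝ) ≤ p := Nat.cast_nonneg p
  rw [pi_norm_le_iff_of_nonneg (zpow_nonneg hp0 _)]
  simp only [padicCoords_coe, Padic.norm_int_le_pow_iff_dvd]
  constructor
  · intro h
    choose c hc using h
    refine ⟨∑ i, c i • NumberField.RingOfIntegers.basis K i, ?_⟩
    conv_lhs => rw [← (NumberField.RingOfIntegers.basis K).sum_repr x]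
    rw [Finset.mul_sum]
    refine Finset.sum_congr rfl fun i _ => ?_
    rw [hc i, mul_smul, zsmul_eq_mul]
    push_cast
    rfl
  · rintro ⟨y, rfl⟩ i
    have : (p : 𝓞 K) ^ n * y = ((p : ℤ) ^ n) • y := by
      rw [zsmul_eq_mul]; push_cast; rfl
    rw [this, map_smul]
    exact ⟨_, rfl⟩

lemma norm_padicCoords_mul_le (x y : K) :
    ‖padicCoords p (x * y)‖ ≤ ‖padicCoords p x‖ * ‖padicCoords p y‖ := by
  let b := NumberField.integralBasis K
  have h : x * y = ∑ i, ∑ j, (b.repr x i * b.repr y j) • (b i * b j) := by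
    conv_lhs => rw [← b.sum_repr x, ← b.sum_repr y]
    simp only [Finset.sum_mul_sum, smul_mul_smul_comm]
  rw [h, map_sum]
  refine IsUltrametricDist.norm_sum_le_of_forall_le_of_nonneg (by positivity) fun i _ => ?_
  rw [map_sum]
  refine IsUltrametricDist.norm_sum_le_of_forall_le_of_nonneg (by positivity) fun j _ => ?_
  rw [norm_padicCoords_smul, Rat.cast_mul, norm_mul]
  have h1 : ‖padicCoords p (b i * b j)‖ ≤ 1 := by
    simp only [b, NumberField.integralBasis_apply, ← map_mul]
    exact norm_padicCoords_coe_le_one p _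
  calc _ ≤ ‖padicCoords p x‖ * ‖padicCoords p y‖ * 1 := by
        gcongr
        · exact norm_le_pi_norm (padicCoords p x) i
        · exact norm_le_pi_norm (padicCoords p y) j
    _ = _ := mul_one _

lemma norm_padicCoords_pow_le (x : K) (n : ℕ) :
    ‖padicCoords p (x ^ n)‖ ≤ ‖padicCoords p x‖ ^ n := by
  induction n with
  | zero => simpa using norm_padicCoords_coe_le_one p (1 : 𝓞 K)
  | succ n ih =>
    rw [pow_succ, pow_succ]
    exact (norm_padicCoords_mul_le p _ _).trans (by gcongr)

/-! ### The `p`-adic logarithm of a unit -/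

/-- `(1 + w) ^ M = 1 + M w + O(w ^ 2)`, where the implied constant is `p |M|`. -/
lemma exists_one_add_pow_eq {w : K} (hw : ‖padicCoords p w‖ ≤ (p : ℝ)⁻¹) (M : ℕ) :
    ∃ R : K, (1 + w) ^ M - 1 = M * (w + R) ∧
      ‖padicCoords p R‖ ≤ p * ‖padicCoords p w‖ ^ 2 := by
  have hp0 : (0 : ℝ) < p := by exact_mod_cast hp.out.pos
  rcases M with _ | m
  · exact ⟨0, by simp, by rw [map_zero, norm_zero]; exact mul_nonneg hp0.le (sq_nonneg _)⟩
  -- `choose (m + 1) (k + 2) = (m + 1) * choose m (k + 1) / (k + 2)`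
  refine ⟨∑ k ∈ Finset.range m, ((m.choose (k + 1) : ℚ) * ((k + 2 : ℕ) : ℚ)⁻¹) • w ^ (k + 2),
    ?_, ?_⟩
  · rw [add_comm, add_pow, Finset.sum_range_succ', Finset.sum_range_succ']
    simp only [one_pow, mul_one, zero_add, pow_one, pow_zero, Nat.choose_one_right,
      Nat.choose_zero_right, Nat.cast_one, add_sub_cancel_right]
    rw [mul_add, add_comm, mul_comm w, Finset.mul_sum]
    congr 1
    refine Finset.sum_congr rfl fun k _ => ?_
    have h := Nat.add_one_mul_choose_eq m (k + 1)
    have h' : ((m + 1 : ℕ) : K) * (m.choose (k + 1) : K) =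
        ((m + 1).choose (k + 1 + 1) : K) * ((k + 2 : ℕ) : K) := by exact_mod_cast h
    have hne : ((k + 2 : ℕ) : K) ≠ 0 := Nat.cast_ne_zero.mpr (by omega)
    rw [Algebra.smul_def, map_mul, map_inv₀, map_natCast, map_natCast, ← mul_assoc, ← mul_assoc, h',
      mul_inv_cancel_right₀ hne, mul_comm]
  · rw [map_sum]
    refine IsUltrametricDist.norm_sum_le_of_forall_le_of_nonneg (by positivity) fun k _ => ?_
    rw [norm_padicCoords_smul]
    push_cast
    rw [norm_mul]
    have h1 : ‖(k + 2 : ℚ_[p])⁻¹‖ ≤ (p : ℝ) ^ (k + 1) := by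
      have h2 : k + 2 ≤ p ^ (k + 1) := (Nat.lt_two_pow_self (n := k + 1)).trans_le
        (Nat.pow_le_pow_left hp.out.two_le _)
      calc _ = ‖((k + 2 : ℕ) : ℚ_[p])⁻¹‖ := by push_cast; rfl
        _ ≤ ((k + 2 : ℕ) : ℝ) := Padic.norm_natCast_inv_le p _
        _ ≤ _ := by exact_mod_cast h2
    have h3 : ‖padicCoords p (w ^ (k + 2))‖ ≤ ‖padicCoords p w‖ ^ 2 * (p : ℝ)⁻¹ ^ k := by
      refine (norm_padicCoords_pow_le p w _).trans ?_
      rw [add_comm, pow_add]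
      gcongr
    calc _ ≤ 1 * (p : ℝ) ^ (k + 1) * (‖padicCoords p w‖ ^ 2 * (p : ℝ)⁻¹ ^ k) := by
          gcongr
          exact Padic.norm_natCast_le_one p _
      _ = p * ‖padicCoords p w‖ ^ 2 := by
          rw [inv_pow, pow_succ]
          field_simp

/-- If `v ≡ 1 mod p ^ 2`, then `(v ^ M - 1) / M` has the norm of `v - 1`. -/
lemma norm_padicCoords_pow_sub_one {v : K} (hv : ‖padicCoords p (v - 1)‖ ≤ (p : ℝ)⁻¹ ^ 2) (M : ℕ) :
    ‖padicCoords p (v ^ M - 1)‖ = ‖(M : ℚ_[p])‖ * ‖padicCoords p (v - 1)‖ := by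
  have hp1 : (1 : ℝ) < p := by exact_mod_cast hp.out.one_lt
  have hpi : (p : ℝ)⁻¹ < 1 := inv_lt_one_of_one_lt₀ hp1
  have hle : ‖padicCoords p (v - 1)‖ ≤ (p : ℝ)⁻¹ :=
    hv.trans (by rw [sq]; exact mul_le_of_le_one_left (by positivity) hpi.le)
  obtain ⟨R, hR, hRn⟩ := exists_one_add_pow_eq p hle M
  rw [add_sub_cancel] at hR
  have hMR : (M : K) * (v - 1 + R) = (M : ℚ) • (v - 1 + R) := by
    rw [Algebra.smul_def, map_natCast]
  rw [hR, hMR, norm_padicCoords_smul, Rat.cast_natCast, map_add]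
  congr 1
  rcases eq_or_ne (padicCoords p (v - 1)) 0 with h0 | h0
  · rw [h0, norm_zero] at hRn
    have : padicCoords p R = 0 := norm_le_zero_iff.mp (by simpa using hRn)
    rw [h0, this, add_zero]
  · have hpos := norm_pos_iff.mpr h0
    -- the error term is strictly smaller, and the norm is ultrametric
    have hlt : ‖padicCoords p R‖ < ‖padicCoords p (v - 1)‖ := by
      calc _ ≤ (p : ℝ) * ‖padicCoords p (v - 1)‖ ^ 2 := hRn
        _ ≤ p * ((p : ℝ)⁻¹ ^ 2 * ‖padicCoords p (v - 1)‖) := by rw [sq ‖_‖]; gcongr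
        _ = (p : ℝ)⁻¹ * ‖padicCoords p (v - 1)‖ := by field_simp
        _ < 1 * ‖padicCoords p (v - 1)‖ := by gcongr
        _ = _ := one_mul _
    rw [IsUltrametricDist.norm_add_eq_max_of_norm_ne_norm hlt.ne', max_eq_left hlt.le]

variable {u : K} {m : ℕ}

/-- The norms of `u ^ n! - 1` are eventually those of `n!`, up to a constant. -/
lemma norm_padicCoords_pow_factorial_sub_one (hm : m ≠ 0)
    (hu : ‖padicCoords p (u ^ m - 1)‖ ≤ (p : ℝ)⁻¹ ^ 2) {n : ℕ} (hn : m ≤ n) :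
    ‖padicCoords p (u ^ n.factorial - 1)‖ =
      ‖(n.factorial : ℚ_[p])‖ * (‖(m : ℚ_[p])‖⁻¹ * ‖padicCoords p (u ^ m - 1)‖) := by
  obtain ⟨k, hk⟩ := Nat.dvd_factorial (Nat.pos_of_ne_zero hm) hn
  have hm' : ‖(m : ℚ_[p])‖ ≠ 0 := norm_ne_zero_iff.mpr (Nat.cast_ne_zero.mpr hm)
  rw [hk, pow_mul, norm_padicCoords_pow_sub_one p hu, Nat.cast_mul, norm_mul]
  field_simp

lemma tendsto_padicCoords_pow_factorial_sub_one (hm : m ≠ 0)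
    (hu : ‖padicCoords p (u ^ m - 1)‖ ≤ (p : ℝ)⁻¹ ^ 2) :
    Filter.Tendsto (fun n : ℕ => padicCoords p (u ^ n.factorial - 1)) Filter.atTop (𝓝 0) := by
  rw [tendsto_zero_iff_norm_tendsto_zero]
  have h := (tendsto_zero_iff_norm_tendsto_zero.mp (Padic.tendsto_factorial p)).mul_const
    (‖(m : ℚ_[p])‖⁻¹ * ‖padicCoords p (u ^ m - 1)‖)
  rw [zero_mul] at h
  refine h.congr' ?_
  filter_upwards [Filter.eventually_ge_atTop m] with n hn
  rw [norm_padicCoords_pow_factorial_sub_one p hm hu hn]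

lemma exists_tendsto_padicCoords (hm : m ≠ 0)
    (hu : ‖padicCoords p (u ^ m - 1)‖ ≤ (p : ℝ)⁻¹ ^ 2) :
    ∃ l, Filter.Tendsto (fun n : ℕ => padicCoords p ((u ^ n.factorial - 1) / n.factorial))
      Filter.atTop (𝓝 l) := by
  have hp1 : (1 : ℝ) < p := by exact_mod_cast hp.out.one_lt
  refine cauchySeq_tendsto_of_complete
    (NonarchimedeanAddGroup.cauchySeq_of_tendsto_sub_nhds_zero ?_)
  set c := ‖(m : ℚ_[p])‖⁻¹ * ‖padicCoords p (u ^ m - 1)‖ with hc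
  have hlim : Filter.Tendsto (fun n : ℕ => p * c ^ 2 * ‖(n.factorial : ℚ_[p])‖) Filter.atTop
      (𝓝 0) := by
    simpa using (tendsto_zero_iff_norm_tendsto_zero.mp (Padic.tendsto_factorial p)).const_mul
      (p * c ^ 2)
  refine squeeze_zero_norm' ?_ hlim
  have hsmall := (tendsto_zero_iff_norm_tendsto_zero.mp
    (tendsto_padicCoords_pow_factorial_sub_one p hm hu)).eventually_le_const
    (show (0 : ℝ) < (p : ℝ)⁻¹ by positivity)
  filter_upwards [Filter.eventually_ge_atTop m, hsmall] with n hn hs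
  obtain ⟨R, hR, hRn⟩ := exists_one_add_pow_eq p hs (n + 1)
  rw [norm_padicCoords_pow_factorial_sub_one p hm hu hn, ← hc] at hRn
  rw [add_sub_cancel, ← pow_mul, mul_comm n.factorial, ← Nat.factorial_succ] at hR
  have hf : (n.factorial : K) ≠ 0 := Nat.cast_ne_zero.mpr n.factorial_ne_zero
  have hn1 : ((n + 1 : ℕ) : K) ≠ 0 := Nat.cast_ne_zero.mpr n.succ_ne_zero
  have hdiff : (u ^ (n + 1).factorial - 1) / ((n + 1).factorial : K) -
      (u ^ n.factorial - 1) / (n.factorial : K) = R / n.factorial := by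
    rw [hR, Nat.factorial_succ, Nat.cast_mul]
    field_simp
    ring
  have hfp : ‖(n.factorial : ℚ_[p])‖ ≠ 0 :=
    norm_ne_zero_iff.mpr (Nat.cast_ne_zero.mpr n.factorial_ne_zero)
  rw [← map_sub, hdiff, norm_padicCoords_div_natCast]
  calc _ ≤ ‖(n.factorial : ℚ_[p])‖⁻¹ * (p * (‖(n.factorial : ℚ_[p])‖ * c) ^ 2) := by gcongr
    _ = _ := by field_simp

/-- If `u ^ m ≡ 1 mod p ^ 2`, then `|m| |log u| = |u ^ m - 1|`. -/
lemma norm_eq_of_tendsto_padicCoords (hm : m ≠ 0)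
    (hu : ‖padicCoords p (u ^ m - 1)‖ ≤ (p : ℝ)⁻¹ ^ 2)
    {l : Module.Free.ChooseBasisIndex ℤ (𝓞 K) → ℚ_[p]}
    (hl : Filter.Tendsto (fun n : ℕ => padicCoords p ((u ^ n.factorial - 1) / n.factorial))
      Filter.atTop (𝓝 l)) :
    ‖(m : ℚ_[p])‖ * ‖l‖ = ‖padicCoords p (u ^ m - 1)‖ := by
  have hm' : ‖(m : ℚ_[p])‖ ≠ 0 := norm_ne_zero_iff.mpr (Nat.cast_ne_zero.mpr hm)
  have h : ‖l‖ = ‖(m : ℚ_[p])‖⁻¹ * ‖padicCoords p (u ^ m - 1)‖ := by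
    refine tendsto_nhds_unique hl.norm (tendsto_const_nhds.congr' ?_)
    filter_upwards [Filter.eventually_ge_atTop m] with n hn
    have hfp : ‖(n.factorial : ℚ_[p])‖ ≠ 0 :=
      norm_ne_zero_iff.mpr (Nat.cast_ne_zero.mpr n.factorial_ne_zero)
    rw [norm_padicCoords_div_natCast, norm_padicCoords_pow_factorial_sub_one p hm hu hn,
      inv_mul_cancel_left₀ hfp]
  rw [h, mul_inv_cancel_left₀ hm']

end padicNorm

/-! ### Logarithms of points, as point derivations -/

namespace AlgGroup

variable {A : Type*} [CommRing A] [HopfAlgebra ℚ A] {p : ℕ} [Fact p.Prime]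

/-- The limits that define `log g` need to be checked for generators of the coordinate ring only. -/
lemma exists_isLog_of_adjoin_eq_top (g : Points A ℚ_[p]) {s : Set A} (hs : Algebra.adjoin ℚ s = ⊤)
    (h : ∀ a ∈ s, ∃ l : ℚ_[p], Filter.Tendsto (fun n : ℕ => ((g ^ n.factorial).ofConv a -
      algebraMap ℚ ℚ_[p] (Coalgebra.counit a)) / (n.factorial : ℚ_[p])) Filter.atTop (𝓝 l)) :
    ∃ D : LieAlg A p, IsLog g D := by
  have hconst : ∀ q : ℚ, Filter.Tendsto (fun n : ℕ => ((g ^ n.factorial).ofConv (algebraMap ℚ A q) -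
      algebraMap ℚ ℚ_[p] (Coalgebra.counit (algebraMap ℚ A q))) / (n.factorial : ℚ_[p]))
      Filter.atTop (𝓝 0) := fun q => by
    simp
  have hmul : ∀ a b : A, ∀ l k : ℚ_[p],
      Filter.Tendsto (fun n : ℕ => ((g ^ n.factorial).ofConv a -
        algebraMap ℚ ℚ_[p] (Coalgebra.counit a)) / (n.factorial : ℚ_[p])) Filter.atTop (𝓝 l) →
      Filter.Tendsto (fun n : ℕ => ((g ^ n.factorial).ofConv b -
        algebraMap ℚ ℚ_[p] (Coalgebra.counit b)) / (n.factorial : ℚ_[p])) Filter.atTop (𝓝 k) →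
      Filter.Tendsto (fun n : ℕ => ((g ^ n.factorial).ofConv (a * b) -
        algebraMap ℚ ℚ_[p] (Coalgebra.counit (a * b))) / (n.factorial : ℚ_[p])) Filter.atTop
        (𝓝 (algebraMap ℚ ℚ_[p] (Coalgebra.counit a) * k +
          algebraMap ℚ ℚ_[p] (Coalgebra.counit b) * l)) := fun a b l k ha hb => by
    -- the denominators tend to `0`, so `b (g ^ n!)` tends to `b 1`
    have hb' : Filter.Tendsto (fun n : ℕ => (g ^ n.factorial).ofConv b) Filter.atTop
        (𝓝 (algebraMap ℚ ℚ_[p] (Coalgebra.counit b))) := by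
      have h1 := ((Padic.tendsto_factorial p).mul hb).const_add
        (algebraMap ℚ ℚ_[p] (Coalgebra.counit b))
      rw [zero_mul, add_zero] at h1
      refine h1.congr fun n => ?_
      have : (n.factorial : ℚ_[p]) ≠ 0 := Nat.cast_ne_zero.mpr n.factorial_ne_zero
      field_simp
      ring
    rw [mul_comm (algebraMap ℚ ℚ_[p] (Coalgebra.counit b))]
    refine ((hb.const_mul _).add (ha.mul hb')).congr fun n => ?_
    rw [map_mul, Bialgebra.counit_mul, map_mul]
    ring
  have hadd : ∀ a b : A, ∀ l k : ℚ_[p],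
      Filter.Tendsto (fun n : ℕ => ((g ^ n.factorial).ofConv a -
        algebraMap ℚ ℚ_[p] (Coalgebra.counit a)) / (n.factorial : ℚ_[p])) Filter.atTop (𝓝 l) →
      Filter.Tendsto (fun n : ℕ => ((g ^ n.factorial).ofConv b -
        algebraMap ℚ ℚ_[p] (Coalgebra.counit b)) / (n.factorial : ℚ_[p])) Filter.atTop (𝓝 k) →
      Filter.Tendsto (fun n : ℕ => ((g ^ n.factorial).ofConv (a + b) -
        algebraMap ℚ ℚ_[p] (Coalgebra.counit (a + b))) / (n.factorial : ℚ_[p])) Filter.atTop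
        (𝓝 (l + k)) := fun a b l k ha hb => by
    refine (ha.add hb).congr fun n => ?_
    rw [map_add, map_add, map_add]
    ring
  have hex : ∀ a : A, ∃ l : ℚ_[p], Filter.Tendsto (fun n : ℕ => ((g ^ n.factorial).ofConv a -
      algebraMap ℚ ℚ_[p] (Coalgebra.counit a)) / (n.factorial : ℚ_[p])) Filter.atTop (𝓝 l) := by
    intro a
    have ha : a ∈ Algebra.adjoin ℚ s := hs ▸ Algebra.mem_top
    induction ha using Algebra.adjoin_induction with
    | mem a ha => exact h a ha
    | algebraMap q => exact ⟨0, hconst q⟩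
    | add a b _ _ ha hb =>
      obtain ⟨l, hl⟩ := ha
      obtain ⟨k, hk⟩ := hb
      exact ⟨_, hadd a b l k hl hk⟩
    | mul a b _ _ ha hb =>
      obtain ⟨l, hl⟩ := ha
      obtain ⟨k, hk⟩ := hb
      exact ⟨_, hmul a b l k hl hk⟩
  choose D hD using hex
  have hDmul : ∀ a b, D (a * b) = algebraMap ℚ ℚ_[p] (Coalgebra.counit a) * D b +
      algebraMap ℚ ℚ_[p] (Coalgebra.counit b) * D a := fun a b =>
    tendsto_nhds_unique (hD (a * b)) (hmul a b _ _ (hD a) (hD b))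
  refine ⟨⟨D, fun a b => tendsto_nhds_unique (hD (a + b)) (hadd a b _ _ (hD a) (hD b)),
    fun q a => ?_, hDmul⟩, hD⟩
  rw [Algebra.smul_def, hDmul, tendsto_nhds_unique (hD (algebraMap ℚ A q)) (hconst q), mul_zero,
    add_zero, Bialgebra.counit_algebraMap, Algebra.smul_def]

/-- The homomorphism `a ↦ ε(a) + D(a) δ` to the dual numbers `ℚ_p[δ]` that corresponds to a tangent
vector `D`, where `ε` is the counit. -/
def toDualNumber (D : LieAlg A p) : A →ₐ[ℚ] DualNumber ℚ_[p] where
  toFun a := TrivSqZeroExt.inl (algebraMap ℚ ℚ_[p] (Coalgebra.counit a)) +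
    TrivSqZeroExt.inr ((D : A → ℚ_[p]) a)
  map_one' := by
    have h := D.2.2.2 1 1
    have h0 : (D : A → ℚ_[p]) 1 = 0 := by simpa using h
    rw [h0]
    ext <;> simp
  map_mul' a b := by
    have h := D.2.2.2 a b
    ext
    · simp
    · simp only [h, TrivSqZeroExt.snd_add, TrivSqZeroExt.snd_inl, TrivSqZeroExt.snd_inr, zero_add,
        TrivSqZeroExt.snd_mul, TrivSqZeroExt.fst_add, TrivSqZeroExt.fst_inl, TrivSqZeroExt.fst_inr,
        add_zero, smul_eq_mul, MulOpposite.smul_eq_mul_unop, MulOpposite.unop_op]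
      ring
  map_zero' := by
    have h := D.2.1 0 0
    have h0 : (D : A → ℚ_[p]) 0 = 0 := by simpa using h
    rw [h0]
    ext <;> simp
  map_add' a b := by
    have h := D.2.1 a b
    ext <;> simp [h]
  commutes' q := by
    have h1 := D.2.2.2 1 1
    have h0 : (D : A → ℚ_[p]) 1 = 0 := by simpa using h1
    have h := D.2.2.1 q 1
    rw [h0, smul_zero, ← Algebra.algebraMap_eq_smul_one] at h
    rw [h, TrivSqZeroExt.inr_zero, add_zero, Bialgebra.counit_algebraMap]
    rfl

end AlgGroup

namespace ResGm

/-- A point of `Res_{B/F} 𝔾ₘ` is determined by the coordinates of the unit, because these determine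
its inverse. -/
lemma algHom_ext_coordX {F B R : Type*} [Field F] [CommRing B] [Algebra F B]
    [FiniteDimensional F B] [CommRing R] [Algebra F R] {f g : ResGm F B →ₐ[F] R}
    (h : ∀ j, f (coordX F B j) = g (coordX F B j)) : f = g := by
  refine toUnits_injective (Units.ext ((baseBasis F B R).repr.injective (Finsupp.ext fun j => ?_)))
  rw [val_toUnits, val_toUnits, repr_mapLeft, repr_mapLeft, repr_genX]
  exact h j

/-- A tangent vector is determined by its values on the coordinates of the unit, as these determine
the corresponding point over the dual numbers. -/
lemma lieAlg_ext_coordX {B : Type*} [CommRing B] [Algebra ℚ B] [FiniteDimensional ℚ B]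
    {p : ℕ} [Fact p.Prime] {D E : AlgGroup.LieAlg (ResGm ℚ B) p}
    (h : ∀ j, (D : ResGm ℚ B → ℚ_[p]) (coordX ℚ B j) = (E : ResGm ℚ B → ℚ_[p]) (coordX ℚ B j)) :
    D = E := by
  have key : AlgGroup.toDualNumber D = AlgGroup.toDualNumber E := algHom_ext_coordX fun j => by
    simp [AlgGroup.toDualNumber, h j]
  refine Subtype.ext (funext fun a => ?_)
  have := congrArg TrivSqZeroExt.snd (DFunLike.congr_fun key a)
  simpa [AlgGroup.toDualNumber] using this

end ResGm

lemma Module.Basis.repr_eq_sum {R M ι κ : Type*} [CommSemiring R] [AddCommMonoid M] [Module R M]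
    [Fintype ι] (b : Module.Basis ι R M) (e : Module.Basis κ R M) (z : M) (j : κ) :
    e.repr z j = ∑ i, b.repr z i * e.repr (b i) j := by
  conv_lhs => rw [← b.sum_repr z, map_sum]
  simp [Finsupp.finsetSum_apply]

section unitLog

variable (p : ℕ) [hp : Fact p.Prime] (K : Type*) [Field K] [NumberField K]

/-- The number of units of `𝓞_K / p ^ 2`. -/
def redOrder : ℕ := Nat.card (𝓞 K ⧸ Ideal.span {(p : 𝓞 K) ^ 2})ˣ

lemma finite_quotient_span_pow (n : ℕ) : Finite (𝓞 K ⧸ Ideal.span {(p : 𝓞 K) ^ n}) :=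
  Ideal.finiteQuotientOfFreeOfNeBot _ (by
    rw [Ne, Ideal.span_singleton_eq_bot]
    exact pow_ne_zero _ (Nat.cast_ne_zero.mpr hp.out.ne_zero))

lemma redOrder_ne_zero : redOrder p K ≠ 0 := by
  have := finite_quotient_span_pow p K 2
  exact Nat.card_pos.ne'

variable {K}

lemma map_mk_eq_one_iff (u : (𝓞 K)ˣ) (n : ℕ) :
    Units.map (Ideal.Quotient.mk (Ideal.span {(p : 𝓞 K) ^ n}) :
      𝓞 K →* 𝓞 K ⧸ Ideal.span {(p : 𝓞 K) ^ n}) u = 1 ↔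
      ‖padicCoords p ((u : K) - 1)‖ ≤ (p : ℝ)⁻¹ ^ n := by
  have h : ((u : K) - 1) = (((u : 𝓞 K) - 1 : 𝓞 K) : K) := by simp
  rw [h, inv_pow, ← zpow_natCast, ← zpow_neg, norm_padicCoords_coe_le_pow_iff,
    ← Ideal.mem_span_singleton, ← Ideal.Quotient.eq_zero_iff_mem, map_sub, sub_eq_zero, map_one,
    Units.ext_iff]
  rfl

lemma norm_padicCoords_pow_redOrder_sub_one (u : (𝓞 K)ˣ) :
    ‖padicCoords p ((u : K) ^ redOrder p K - 1)‖ ≤ (p : ℝ)⁻¹ ^ 2 := by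
  have h := (map_mk_eq_one_iff p (u ^ redOrder p K) 2).mp (by rw [map_pow]; exact pow_card_eq_one')
  simpa using h

/-- The `p`-adic logarithm of a unit, in coordinates for an integral basis. -/
def logCoords (u : (𝓞 K)ˣ) : Module.Free.ChooseBasisIndex ℤ (𝓞 K) → ℚ_[p] :=
  (exists_tendsto_padicCoords p (redOrder_ne_zero p K)
    (norm_padicCoords_pow_redOrder_sub_one p u)).choose

lemma tendsto_logCoords (u : (𝓞 K)ˣ) :
    Filter.Tendsto (fun n : ℕ => padicCoords p (((u : K) ^ n.factorial - 1) / n.factorial))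
      Filter.atTop (𝓝 (logCoords p u)) :=
  (exists_tendsto_padicCoords p (redOrder_ne_zero p K)
    (norm_padicCoords_pow_redOrder_sub_one p u)).choose_spec

lemma norm_logCoords {u : (𝓞 K)ˣ} {m : ℕ} (hm : m ≠ 0)
    (hu : ‖padicCoords p ((u : K) ^ m - 1)‖ ≤ (p : ℝ)⁻¹ ^ 2) :
    ‖(m : ℚ_[p])‖ * ‖logCoords p u‖ = ‖padicCoords p ((u : K) ^ m - 1)‖ :=
  norm_eq_of_tendsto_padicCoords p hm hu (tendsto_logCoords p u)

lemma logCoords_mul (u v : (𝓞 K)ˣ) : logCoords p (u * v) = logCoords p u + logCoords p v := by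
  refine tendsto_nhds_unique (tendsto_logCoords p (u * v)) ?_
  -- `(uv) ^ N - 1 = (u ^ N - 1) + (v ^ N - 1) + (u ^ N - 1) (v ^ N - 1)`
  have hz : Filter.Tendsto (fun n : ℕ => padicCoords p (((u : K) ^ n.factorial - 1) *
      (((v : K) ^ n.factorial - 1) / n.factorial))) Filter.atTop (𝓝 0) := by
    have h := (tendsto_zero_iff_norm_tendsto_zero.mp (tendsto_padicCoords_pow_factorial_sub_one p
      (redOrder_ne_zero p K) (norm_padicCoords_pow_redOrder_sub_one p u))).mul
      (tendsto_logCoords p v).norm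
    rw [zero_mul] at h
    exact squeeze_zero_norm (fun n => norm_padicCoords_mul_le p _ _) h
  have h := ((tendsto_logCoords p u).add (tendsto_logCoords p v)).add hz
  rw [add_zero] at h
  refine h.congr fun n => ?_
  rw [← map_add, ← map_add]
  congr 1
  rw [Units.val_mul, map_mul, mul_pow]
  ring

/-! ### The logarithm `𝓞_K^× → Lie T(ℚ_p)` -/

lemma toPadic_unitPoint_pow (u : (𝓞 K)ˣ) (n : ℕ) (a : ResGm ℚ K) :
    ((AlgGroup.toPadic p (unitPoint K u)) ^ n).ofConv a =
      (((unitPoint K (u ^ n)).ofConv a : ℚ) : ℚ_[p]) := by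
  rw [← map_pow, ← map_pow]
  exact eq_ratCast (algebraMap ℚ ℚ_[p]) _

lemma counit_eq_unitPoint_one (a : ResGm ℚ K) :
    Coalgebra.counit (R := ℚ) a = (unitPoint K 1).ofConv a := by
  rw [map_one]
  rfl

/-- The difference quotients of a coordinate of `u` are the coordinates of `(u ^ N - 1) / N`. -/
lemma quotient_coordX (u : (𝓞 K)ˣ) (n : ℕ) (j : Fin (Module.finrank ℚ K)) :
    (((AlgGroup.toPadic p (unitPoint K u)) ^ n).ofConv (ResGm.coordX ℚ K j) -
      algebraMap ℚ ℚ_[p] (Coalgebra.counit (ResGm.coordX ℚ K j))) / (n : ℚ_[p]) =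
    (((Module.finBasis ℚ K).repr (((u : K) ^ n - 1) / n) j : ℚ) : ℚ_[p]) := by
  have h : ((u : K) ^ n - 1) / n = (n : ℚ)⁻¹ • (((u ^ n : (𝓞 K)ˣ) : K) - ((1 : (𝓞 K)ˣ) : K)) := by
    rw [Algebra.smul_def, map_inv₀, map_natCast, div_eq_inv_mul]
    simp
  rw [toPadic_unitPoint_pow, counit_eq_unitPoint_one, eq_ratCast, unitPoint_coordX,
    unitPoint_coordX, h, map_smul, map_sub, Finsupp.smul_apply, Finsupp.sub_apply, smul_eq_mul,
    div_eq_inv_mul]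
  push_cast
  rfl

lemma quotient_coordY (u : (𝓞 K)ˣ) (n : ℕ) (j : Fin (Module.finrank ℚ K)) :
    (((AlgGroup.toPadic p (unitPoint K u)) ^ n).ofConv (ResGm.coordY ℚ K j) -
      algebraMap ℚ ℚ_[p] (Coalgebra.counit (ResGm.coordY ℚ K j))) / (n : ℚ_[p]) =
    (((AlgGroup.toPadic p (unitPoint K u⁻¹)) ^ n).ofConv (ResGm.coordX ℚ K j) -
      algebraMap ℚ ℚ_[p] (Coalgebra.counit (ResGm.coordX ℚ K j))) / (n : ℚ_[p]) := by
  simp only [toPadic_unitPoint_pow, counit_eq_unitPoint_one, unitPoint_coordX, unitPoint_coordY,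
    inv_pow, inv_one]

lemma tendsto_quotient_coordX (u : (𝓞 K)ˣ) (j : Fin (Module.finrank ℚ K)) :
    Filter.Tendsto (fun n : ℕ => (((AlgGroup.toPadic p (unitPoint K u)) ^ n.factorial).ofConv
      (ResGm.coordX ℚ K j) - algebraMap ℚ ℚ_[p] (Coalgebra.counit (ResGm.coordX ℚ K j))) /
      (n.factorial : ℚ_[p])) Filter.atTop (𝓝 (∑ i, logCoords p u i *
        (((Module.finBasis ℚ K).repr (NumberField.integralBasis K i) j : ℚ) : ℚ_[p]))) := by
  simp only [quotient_coordX]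
  have h := tendsto_pi_nhds.mp (tendsto_logCoords p u)
  refine (tendsto_finsetSum Finset.univ fun i _ => (h i).mul_const _).congr fun n => ?_
  rw [Module.Basis.repr_eq_sum (NumberField.integralBasis K)]
  push_cast
  rfl

lemma exists_isLog_unitPoint (u : (𝓞 K)ˣ) :
    ∃ D : AlgGroup.LieAlg (ResGm ℚ K) p, AlgGroup.IsLog (AlgGroup.toPadic p (unitPoint K u)) D := by
  refine AlgGroup.exists_isLog_of_adjoin_eq_top _ ResGm.adjoin_coords ?_
  rintro _ (⟨j, rfl⟩ | ⟨j, rfl⟩)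
  · exact ⟨_, tendsto_quotient_coordX p u j⟩
  · simp only [quotient_coordY]
    exact ⟨_, tendsto_quotient_coordX p u⁻¹ j⟩

/-- The coordinates of a tangent vector of the torus in an integral basis of `K`. -/
def lieCoords : AlgGroup.LieAlg (ResGm ℚ K) p →ₗ[ℚ_[p]]
    (Module.Free.ChooseBasisIndex ℤ (𝓞 K) → ℚ_[p]) where
  toFun D i := ∑ j, (((NumberField.integralBasis K).repr (Module.finBasis ℚ K j) i : ℚ) : ℚ_[p]) *
    (D : ResGm ℚ K → ℚ_[p]) (ResGm.coordX ℚ K j)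
  map_add' D E := by
    ext i
    simp [mul_add, Finset.sum_add_distrib]
  map_smul' c D := by
    ext i
    simp [Finset.mul_sum, mul_left_comm]

lemma lieCoords_injective : Function.Injective (lieCoords p (K := K)) := by
  refine (injective_iff_map_eq_zero _).mpr fun D hD => ResGm.lieAlg_ext_coordX fun j => ?_
  have hδ : ∀ k, ∑ i, (((NumberField.integralBasis K).repr (Module.finBasis ℚ K k) i : ℚ) : ℚ_[p]) *
      (((Module.finBasis ℚ K).repr (NumberField.integralBasis K i) j : ℚ) : ℚ_[p]) =
      if k = j then 1 else 0 := fun k => by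
    have h := Module.Basis.repr_eq_sum (NumberField.integralBasis K) (Module.finBasis ℚ K)
      (Module.finBasis ℚ K k) j
    rw [Module.Basis.repr_self, Finsupp.single_apply] at h
    have h2 := congrArg (Rat.cast : ℚ → ℚ_[p]) h
    push_cast at h2
    rw [← h2]
    split_ifs <;> simp
  calc (D : ResGm ℚ K → ℚ_[p]) (ResGm.coordX ℚ K j)
      = ∑ k, (if k = j then 1 else 0) * (D : ResGm ℚ K → ℚ_[p]) (ResGm.coordX ℚ K k) := by simp
    _ = ∑ i, lieCoords p D i *
        (((Module.finBasis ℚ K).repr (NumberField.integralBasis K i) j : ℚ) : ℚ_[p]) := by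
      simp only [← hδ, Finset.sum_mul, lieCoords, LinearMap.coe_mk, AddHom.coe_mk]
      rw [Finset.sum_comm]
      refine Finset.sum_congr rfl fun i _ => Finset.sum_congr rfl fun k _ => ?_
      ring
    _ = 0 := by simp [hD]

lemma lieCoords_of_isLog {u : (𝓞 K)ˣ} {D : AlgGroup.LieAlg (ResGm ℚ K) p}
    (hD : AlgGroup.IsLog (AlgGroup.toPadic p (unitPoint K u)) D) :
    lieCoords p D = logCoords p u := by
  refine tendsto_nhds_unique ?_ (tendsto_logCoords p u)
  refine tendsto_pi_nhds.mpr fun i => ?_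
  refine (tendsto_finsetSum Finset.univ fun j _ =>
    (hD (ResGm.coordX ℚ K j)).const_mul _).congr fun n => ?_
  rw [padicCoords_apply, Module.Basis.repr_eq_sum (Module.finBasis ℚ K)]
  simp only [quotient_coordX]
  push_cast
  exact Finset.sum_congr rfl fun j _ => mul_comm _ _

/-- The logarithm of a unit. -/
def lieLog (u : (𝓞 K)ˣ) : AlgGroup.LieAlg (ResGm ℚ K) p := (exists_isLog_unitPoint p u).choose

lemma isLog_lieLog (u : (𝓞 K)ˣ) :
    AlgGroup.IsLog (AlgGroup.toPadic p (unitPoint K u)) (lieLog p u) :=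
  (exists_isLog_unitPoint p u).choose_spec

lemma lieCoords_lieLog (u : (𝓞 K)ˣ) : lieCoords p (lieLog p u) = logCoords p u :=
  lieCoords_of_isLog p (isLog_lieLog p u)

lemma lieLog_mul (u v : (𝓞 K)ˣ) : lieLog p (u * v) = lieLog p u + lieLog p v :=
  lieCoords_injective p <| by
    rw [map_add, lieCoords_lieLog, lieCoords_lieLog, lieCoords_lieLog, logCoords_mul]

/-- The logarithm `𝓞_K^× → Lie T(ℚ_p)`. -/
def unitLog : Additive (𝓞 K)ˣ →ₗ[ℤ] AlgGroup.LieAlg (ResGm ℚ K) p :=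
  AddMonoidHom.toIntLinearMap (AddMonoidHom.mk' (fun u => lieLog p u.toMul)
    fun u v => lieLog_mul p u.toMul v.toMul)

lemma unitLog_ofMul (u : (𝓞 K)ˣ) : unitLog p (Additive.ofMul u) = lieLog p u := rfl

lemma logSet_unitSubgroup :
    AlgGroup.logSet p (unitSubgroup K) = Set.range (unitLog p (K := K)) := by
  ext D
  constructor
  · rintro ⟨g, hg, hD⟩
    rw [← range_unitPoint] at hg
    obtain ⟨u, rfl⟩ := hg
    refine ⟨Additive.ofMul u, lieCoords_injective p ?_⟩
    rw [unitLog_ofMul, lieCoords_lieLog, lieCoords_of_isLog p hD]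
  · rintro ⟨u, rfl⟩
    exact ⟨unitPoint K u.toMul, unitPoint_mem _, isLog_lieLog p u.toMul⟩

end unitLog

/-! ### The tensor product of an abelian group with `ℤ_p` -/

namespace PadicInt

variable (p : ℕ) [hp : Fact p.Prime] {M : Type*} [AddCommGroup M]

/-- `M` is dense in `ℤ_p ⊗ M`. -/
lemma exists_eq_one_tmul_add (k : ℕ) (x : ℤ_[p] ⊗[ℤ] M) :
    ∃ (u : M) (y : ℤ_[p] ⊗[ℤ] M), x = 1 ⊗ₜ u + p ^ k • y := by
  induction x with
  | zero => exact ⟨0, 0, by simp⟩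
  | tmul c v =>
    obtain ⟨c', hc'⟩ := Ideal.mem_span_singleton'.mp (PadicInt.appr_spec k c)
    refine ⟨c.appr k • v, c' ⊗ₜ v, ?_⟩
    have hc : c = (c.appr k : ℤ_[p]) + p ^ k • c' := by
      rw [nsmul_eq_mul, Nat.cast_pow, mul_comm, hc']
      ring
    conv_lhs => rw [hc]
    rw [TensorProduct.add_tmul, TensorProduct.smul_tmul', ← nsmul_one (c.appr k),
      TensorProduct.smul_tmul]
  | add x y hx hy =>
    obtain ⟨u, x', rfl⟩ := hx
    obtain ⟨v, y', rfl⟩ := hy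
    exact ⟨u + v, x' + y', by rw [TensorProduct.tmul_add, smul_add]; abel⟩

/-- The map `M / p ^ N → (ℤ_p ⊗ M) / p ^ N` is injective: the action of `ℤ_p` on `M / p ^ N` through
`ℤ / p ^ N` gives a left inverse. -/
lemma exists_eq_smul_of_one_tmul_eq {N : ℕ} {u : M} {y : ℤ_[p] ⊗[ℤ] M}
    (h : (1 : ℤ_[p]) ⊗ₜ[ℤ] u = p ^ N • y) : ∃ w : M, u = p ^ N • w := by
  let S : AddSubgroup M := (nsmulAddMonoidHom (α := M) (p ^ N)).range
  have hS : ∀ x : M ⧸ S, p ^ N • x = 0 := fun x => by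
    obtain ⟨m, rfl⟩ := QuotientAddGroup.mk_surjective x
    exact (QuotientAddGroup.eq_zero_iff _).mpr ⟨m, rfl⟩
  let := AddCommGroup.zmodModule hS
  let f : ℤ_[p] →+ M →+ M ⧸ S := AddMonoidHom.mk'
    (fun c => (smulAddHom (ZMod (p ^ N)) (M ⧸ S) (toZModPow N c)).comp (QuotientAddGroup.mk' S))
    fun a b => by rw [map_add, map_add, AddMonoidHom.add_comp]
  let φ : ℤ_[p] ⊗[ℤ] M →+ M ⧸ S := TensorProduct.liftAddHom f fun r c m => by
    rw [map_zsmul, map_zsmul]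
    rfl
  have h1 : φ (1 ⊗ₜ u) = QuotientAddGroup.mk' S u := by
    change (toZModPow N 1 : ZMod (p ^ N)) • (QuotientAddGroup.mk' S u) = _
    rw [map_one, one_smul]
  have h2 : φ (1 ⊗ₜ u) = 0 := by rw [h, map_nsmul, hS]
  rw [h1] at h2
  obtain ⟨w, hw⟩ := (QuotientAddGroup.eq_zero_iff u).mp h2
  exact ⟨w, hw.symm⟩

/-- For a finite group `M`, the kernel of `M → ℤ_p ⊗ M` consists of elements of order prime
to `p`. -/
lemma exists_coprime_smul_eq_zero [Finite M] {u : M} (h : (1 : ℤ_[p]) ⊗ₜ[ℤ] u = 0) :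
    ∃ q : ℕ, p.Coprime q ∧ q • u = 0 := by
  obtain ⟨w, hw⟩ := exists_eq_smul_of_one_tmul_eq p (N := (Nat.card M).factorization p) (u := u)
    (y := 0) (by rw [h, smul_zero])
  refine ⟨_, Nat.coprime_ordCompl hp.out (Nat.card_pos (α := M)).ne', ?_⟩
  rw [hw, ← mul_smul, mul_comm, Nat.ordProj_mul_ordCompl_eq_self]
  exact card_nsmul_eq_zero'

/-- A power of `p` annihilates `ℤ_p ⊗ M` for a finite group `M`. -/
lemma exists_pow_smul_eq_zero (M : Type*) [AddCommGroup M] [Finite M] :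
    ∃ a : ℕ, ∀ y : ℤ_[p] ⊗[ℤ] M, p ^ a • y = 0 := by
  refine ⟨(Nat.card M).factorization p, fun y => ?_⟩
  have hcard : Nat.card M • y = 0 := by
    induction y with
    | zero => simp
    | tmul c v => rw [← TensorProduct.tmul_smul, card_nsmul_eq_zero', TensorProduct.tmul_zero]
    | add x y hx hy => rw [smul_add, hx, hy, add_zero]
  set q := Nat.card M / p ^ (Nat.card M).factorization p with hq
  have hunit : IsUnit (q : ℤ_[p]) := isUnit_iff.mpr
    (norm_natCast_eq_one_iff.mpr (Nat.coprime_ordCompl hp.out (Nat.card_pos (α := M)).ne'))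
  rw [← Nat.ordProj_mul_ordCompl_eq_self (Nat.card M) p, mul_comm, mul_smul,
    ← Nat.cast_smul_eq_nsmul ℤ_[p], hunit.smul_eq_zero] at hcard
  exact hcard

/-- An element of `ℤ_p ⊗ M` that is divisible by all powers of `p` is zero, if `M` is finitely
generated. -/
lemma eq_zero_of_forall_exists_eq_pow_smul [Module.Finite ℤ M] {x : ℤ_[p] ⊗[ℤ] M}
    (h : ∀ k : ℕ, ∃ y, x = p ^ k • y) : x = 0 := by
  have hI : Ideal.span {(p : ℤ_[p])} ≠ ⊤ := by
    rw [← PadicInt.maximalIdeal_eq_span_p]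
    exact Ideal.IsPrime.ne_top'
  have hx : x ∈ ⨅ k : ℕ, Ideal.span {(p : ℤ_[p])} ^ k • (⊤ : Submodule ℤ_[p] (ℤ_[p] ⊗[ℤ] M)) := by
    refine Submodule.mem_iInf _ |>.mpr fun k => ?_
    obtain ⟨y, rfl⟩ := h k
    rw [← Nat.cast_smul_eq_nsmul ℤ_[p], Nat.cast_pow]
    exact Submodule.smul_mem_smul (Ideal.pow_mem_pow (Ideal.mem_span_singleton_self _) k) trivial
  rwa [Ideal.iInf_pow_smul_eq_bot_of_isLocalRing _ hI, Submodule.mem_bot] at hx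

/-- A torsion element of a `ℤ_p`-module is annihilated by a power of `p`. -/
lemma exists_pow_smul_eq_zero_of_smul_eq_zero {N : Type*} [AddCommGroup N] [Module ℤ_[p] N]
    {c : ℤ_[p]} (hc : c ≠ 0) {x : N} (h : c • x = 0) : ∃ j : ℕ, p ^ j • x = 0 := by
  refine ⟨c.valuation, ?_⟩
  rw [unitCoeff_spec hc, mul_smul, (unitCoeff hc).isUnit.smul_eq_zero] at h
  rw [← Nat.cast_smul_eq_nsmul ℤ_[p], Nat.cast_pow]
  exact h

end PadicInt

/-! ### The Leopoldt map and the logarithm -/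

section Leopoldt

variable (p : ℕ) [hp : Fact p.Prime] {K : Type*} [Field K] [NumberField K]

lemma unitReduction_ofMul_eq_zero_iff (u : (𝓞 K)ˣ) (n : ℕ) :
    unitReduction K p n (Additive.ofMul u) = 0 ↔
      ‖padicCoords p ((u : K) - 1)‖ ≤ (p : ℝ)⁻¹ ^ n :=
  map_mk_eq_one_iff p u n

lemma norm_padicCoords_unit_le (u : (𝓞 K)ˣ) {n : ℕ} (hn : 2 ≤ n)
    (h : ‖padicCoords p ((u : K) - 1)‖ ≤ (p : ℝ)⁻¹ ^ n) :
    ‖padicCoords p ((u : K) - 1)‖ ≤ (p : ℝ)⁻¹ ^ 2 :=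
  h.trans (pow_le_pow_of_le_one (by positivity)
    (inv_le_one_of_one_le₀ (by exact_mod_cast hp.out.one_lt.le)) hn)

variable (K) in
/-- The logarithm `ℤ_p ⊗ 𝓞_K^× → Lie T(ℚ_p)`. -/
def tensorLog : ℤ_[p] ⊗[ℤ] Additive (𝓞 K)ˣ →ₗ[ℤ_[p]] AlgGroup.LieAlg (ResGm ℚ K) p :=
  LinearMap.liftBaseChange ℤ_[p] (unitLog p)

variable (K) in
/-- The logarithm `ℤ_p ⊗ 𝓞_K^× → ℚ_p ⊗ K` in coordinates for an integral basis of `K`. -/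
def tensorLogCoords : ℤ_[p] ⊗[ℤ] Additive (𝓞 K)ˣ →ₗ[ℤ_[p]]
    (Module.Free.ChooseBasisIndex ℤ (𝓞 K) → ℚ_[p]) :=
  (lieCoords p).restrictScalars ℤ_[p] ∘ₗ tensorLog p K

lemma tensorLogCoords_tmul (c : ℤ_[p]) (u : (𝓞 K)ˣ) :
    tensorLogCoords p K (c ⊗ₜ Additive.ofMul u) = (c : ℚ_[p]) • logCoords p u := by
  rw [tensorLogCoords, LinearMap.comp_apply, tensorLog, LinearMap.liftBaseChange_tmul, map_smul,
    unitLog_ofMul]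
  change c • lieCoords p (lieLog p u) = _
  rw [lieCoords_lieLog]
  rfl

lemma tensorLogCoords_one_tmul (u : (𝓞 K)ˣ) :
    tensorLogCoords p K (1 ⊗ₜ Additive.ofMul u) = logCoords p u := by
  rw [tensorLogCoords_tmul, PadicInt.coe_one, one_smul]

lemma norm_tensorLogCoords_le (y : ℤ_[p] ⊗[ℤ] Additive (𝓞 K)ˣ) :
    ‖tensorLogCoords p K y‖ ≤ ‖(redOrder p K : ℚ_[p])‖⁻¹ := by
  have hm : 0 < ‖(redOrder p K : ℚ_[p])‖ :=
    norm_pos_iff.mpr (Nat.cast_ne_zero.mpr (redOrder_ne_zero p K))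
  induction y with
  | zero => simp
  | tmul c u =>
    obtain ⟨u, rfl⟩ := Additive.ofMul.surjective u
    rw [tensorLogCoords_tmul, norm_smul]
    have h1 := norm_logCoords p (redOrder_ne_zero p K) (norm_padicCoords_pow_redOrder_sub_one p u)
    have h2 : ‖logCoords p u‖ ≤ ‖(redOrder p K : ℚ_[p])‖⁻¹ := by
      rw [← one_div, le_div_iff₀ hm, mul_comm, h1]
      have := norm_padicCoords_coe_le_one p ((u : 𝓞 K) ^ redOrder p K - 1)
      simpa using this
    calc _ ≤ 1 * ‖(redOrder p K : ℚ_[p])‖⁻¹ := by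
          gcongr
          exact c.2
      _ = _ := one_mul _
  | add x y hx hy =>
    rw [map_add]
    exact (IsUltrametricDist.norm_add_le_max _ _).trans (max_le hx hy)

lemma norm_pow_smul_tensorLogCoords_le (k : ℕ) (y : ℤ_[p] ⊗[ℤ] Additive (𝓞 K)ˣ) :
    ‖tensorLogCoords p K (p ^ k • y)‖ ≤ (p : ℝ)⁻¹ ^ k * ‖(redOrder p K : ℚ_[p])‖⁻¹ := by
  rw [map_nsmul, ← Nat.cast_smul_eq_nsmul ℚ_[p], norm_smul, Nat.cast_pow, norm_pow, Padic.norm_p]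
  gcongr
  exact norm_tensorLogCoords_le p y

lemma exists_pow_smul_lTensor_unitReduction_eq_zero (n : ℕ) :
    ∃ a : ℕ, ∀ k, a ≤ k → ∀ y : ℤ_[p] ⊗[ℤ] Additive (𝓞 K)ˣ,
      (unitReduction K p n).lTensor ℤ_[p] (p ^ k • y) = 0 := by
  have := finite_quotient_span_pow p K n
  obtain ⟨a, ha⟩ := PadicInt.exists_pow_smul_eq_zero p
    (Additive (𝓞 K ⧸ Ideal.span {(p : 𝓞 K) ^ n})ˣ)
  refine ⟨a, fun k hk y => ?_⟩
  rw [map_nsmul, ← Nat.sub_add_cancel hk, pow_add, mul_smul, ha, smul_zero]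

/-- The kernel of the Leopoldt map is contained in the kernel of the logarithm. -/
lemma tensorLogCoords_eq_zero {x : ℤ_[p] ⊗[ℤ] Additive (𝓞 K)ˣ}
    (hx : ∀ n : ℕ, (unitReduction K p n).lTensor ℤ_[p] x = 0) : tensorLogCoords p K x = 0 := by
  have hp1 : (1 : ℝ) < p := by exact_mod_cast hp.out.one_lt
  have hpi : (p : ℝ)⁻¹ < 1 := inv_lt_one_of_one_lt₀ hp1
  set C := ‖(redOrder p K : ℚ_[p])‖⁻¹ with hC
  have hbound : ∀ n : ℕ, 2 ≤ n → ‖tensorLogCoords p K x‖ ≤ (p : ℝ)⁻¹ ^ n * max 1 C := by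
    intro n hn
    obtain ⟨a, ha⟩ := exists_pow_smul_lTensor_unitReduction_eq_zero (K := K) p n
    obtain ⟨u, y, rfl⟩ := PadicInt.exists_eq_one_tmul_add p (max n a) x
    obtain ⟨u, rfl⟩ := Additive.ofMul.surjective u
    have h1 := hx n
    rw [map_add, ha _ (le_max_right _ _), add_zero, LinearMap.lTensor_tmul] at h1
    have := finite_quotient_span_pow p K n
    obtain ⟨q, hq, hqu⟩ := PadicInt.exists_coprime_smul_eq_zero p h1
    rw [← map_nsmul, ← ofMul_pow, unitReduction_ofMul_eq_zero_iff] at hqu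
    have hqu2 := norm_padicCoords_unit_le p _ hn hqu
    rw [Units.val_pow_eq_pow_val, map_pow] at hqu hqu2
    have hq0 : q ≠ 0 := by
      rintro rfl
      exact hp.out.one_lt.ne' (by simpa using hq)
    have hlog := norm_logCoords p hq0 hqu2
    rw [Padic.norm_natCast_eq_one_iff.mpr hq, one_mul] at hlog
    rw [map_add, tensorLogCoords_one_tmul]
    refine (IsUltrametricDist.norm_add_le_max _ _).trans (max_le ?_ ?_)
    · rw [hlog]
      exact hqu.trans (le_mul_of_one_le_right (by positivity) (le_max_left _ _))
    · refine (norm_pow_smul_tensorLogCoords_le p _ y).trans ?_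
      exact mul_le_mul (pow_le_pow_of_le_one (by positivity) hpi.le (le_max_left _ _))
        (le_max_right _ _) (by positivity) (by positivity)
  rw [← norm_le_zero_iff]
  have hlim : Filter.Tendsto (fun n : ℕ => (p : ℝ)⁻¹ ^ n * max 1 C) Filter.atTop (𝓝 0) := by
    simpa using (tendsto_pow_atTop_nhds_zero_of_lt_one (by positivity) hpi).mul_const (max 1 C)
  exact ge_of_tendsto hlim (Filter.eventually_atTop.mpr ⟨2, hbound⟩)

/-- A multiple of the kernel of the logarithm is contained in the kernel of the Leopoldt map. -/
lemma lTensor_unitReduction_redOrder_smul_eq_zero {x : ℤ_[p] ⊗[ℤ] Additive (𝓞 K)ˣ}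
    (hx : tensorLogCoords p K x = 0) (n : ℕ) :
    (unitReduction K p n).lTensor ℤ_[p] (redOrder p K • x) = 0 := by
  have hp1 : (1 : ℝ) < p := by exact_mod_cast hp.out.one_lt
  have hpi : (p : ℝ)⁻¹ < 1 := inv_lt_one_of_one_lt₀ hp1
  have hm : 0 < ‖(redOrder p K : ℚ_[p])‖ :=
    norm_pos_iff.mpr (Nat.cast_ne_zero.mpr (redOrder_ne_zero p K))
  obtain ⟨a, ha⟩ := exists_pow_smul_lTensor_unitReduction_eq_zero (K := K) p n
  obtain ⟨u, y, rfl⟩ := PadicInt.exists_eq_one_tmul_add p (max n a) x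
  obtain ⟨u, rfl⟩ := Additive.ofMul.surjective u
  rw [map_nsmul, map_add, ha _ (le_max_right _ _), add_zero, LinearMap.lTensor_tmul,
    ← TensorProduct.tmul_smul, ← map_nsmul, ← ofMul_pow,
    (unitReduction_ofMul_eq_zero_iff p _ n).mpr, TensorProduct.tmul_zero]
  rw [map_add, tensorLogCoords_one_tmul] at hx
  rw [Units.val_pow_eq_pow_val, map_pow,
    ← norm_logCoords p (redOrder_ne_zero p K) (norm_padicCoords_pow_redOrder_sub_one p u),
    eq_neg_of_add_eq_zero_left hx, norm_neg]
  calc _ ≤ ‖(redOrder p K : ℚ_[p])‖ * ((p : ℝ)⁻¹ ^ max n a * ‖(redOrder p K : ℚ_[p])‖⁻¹) := by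
        gcongr
        exact norm_pow_smul_tensorLogCoords_le p _ y
    _ = (p : ℝ)⁻¹ ^ max n a := by field_simp
    _ ≤ _ := pow_le_pow_of_le_one (by positivity) hpi.le (le_max_left _ _)

/-- The Leopoldt map is injective on torsion: a root of unity of `p`-power order that is congruent
to `1` modulo `p ^ 2` is `1`. -/
lemma eq_zero_of_torsion {x : ℤ_[p] ⊗[ℤ] Additive (𝓞 K)ˣ} {j : ℕ} (hj : p ^ j • x = 0)
    (hx : (unitReduction K p 2).lTensor ℤ_[p] x = 0) : x = 0 := by
  refine PadicInt.eq_zero_of_forall_exists_eq_pow_smul p fun k => ?_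
  obtain ⟨a, ha⟩ := exists_pow_smul_lTensor_unitReduction_eq_zero (K := K) p 2
  obtain ⟨u, y, rfl⟩ := PadicInt.exists_eq_one_tmul_add p (max k a) x
  obtain ⟨w, hw⟩ := PadicInt.exists_eq_smul_of_one_tmul_eq p (N := j + max k a) (u := p ^ j • u)
    (y := -y) (by
      rw [smul_add, ← TensorProduct.tmul_smul] at hj
      rw [eq_neg_of_add_eq_zero_left hj, ← mul_smul, ← pow_add, smul_neg])
  -- Modulo `p ^ k`, the element `x` is the root of unity `ζ`.
  obtain ⟨ζ, hζ⟩ := Additive.ofMul.surjective (u - p ^ max k a • w)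
  have hu : u = Additive.ofMul ζ + p ^ max k a • w := by rw [hζ, sub_add_cancel]
  have hζj : p ^ j • Additive.ofMul ζ = 0 := by
    rw [hζ, nsmul_sub, hw, pow_add, mul_smul, sub_self]
  have hxζ : (1 : ℤ_[p]) ⊗ₜ[ℤ] u + p ^ max k a • y =
      1 ⊗ₜ Additive.ofMul ζ + p ^ max k a • (1 ⊗ₜ w + y) := by
    rw [hu, TensorProduct.tmul_add, TensorProduct.tmul_smul, smul_add, add_assoc]
  rw [hxζ, map_add, ha _ (le_max_right _ _), add_zero, LinearMap.lTensor_tmul] at hx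
  have := finite_quotient_span_pow p K 2
  obtain ⟨q, hq, hqζ⟩ := PadicInt.exists_coprime_smul_eq_zero p hx
  have hred : unitReduction K p 2 (Additive.ofMul ζ) = 0 := by
    have h1 : addOrderOf (unitReduction K p 2 (Additive.ofMul ζ)) ∣ p ^ j :=
      addOrderOf_dvd_iff_nsmul_eq_zero.mpr (by rw [← map_nsmul, hζj, map_zero])
    have h2 := addOrderOf_dvd_iff_nsmul_eq_zero.mpr hqζ
    exact AddMonoid.addOrderOf_eq_one_iff.mp
      (Nat.eq_one_of_dvd_coprimes (hq.pow_left j) h1 h2)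
  rw [unitReduction_ofMul_eq_zero_iff] at hred
  have hnorm := norm_padicCoords_pow_sub_one p hred (p ^ j)
  have hζ1 : ζ ^ p ^ j = 1 := hζj
  rw [← map_pow, ← Units.val_pow_eq_pow_val, hζ1, Units.val_one, map_one, sub_self, map_zero,
    norm_zero, eq_comm, mul_eq_zero, norm_eq_zero, norm_eq_zero, Nat.cast_eq_zero] at hnorm
  have hζ0 : ζ = 1 := by
    have h := hnorm.resolve_left (pow_ne_zero _ hp.out.ne_zero)
    rw [map_eq_zero_iff _ (padicCoords_injective p), sub_eq_zero,
      ← map_one (algebraMap (𝓞 K) K)] at h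
    exact Units.ext (FaithfulSMul.algebraMap_injective (𝓞 K) K h)
  refine ⟨p ^ (max k a - k) • (1 ⊗ₜ w + y), ?_⟩
  rw [hxζ, hζ0, ofMul_one, TensorProduct.tmul_zero, zero_add, ← mul_smul, ← pow_add,
    Nat.add_sub_cancel' (le_max_left _ _)]

lemma leopoldtConjecture_iff :
    LeopoldtConjecture K p ↔ Module.IsTorsion ℤ_[p] (LinearMap.ker (tensorLog p K)) := by
  have hker : ∀ x, tensorLog p K x = 0 ↔ tensorLogCoords p K x = 0 := fun x =>
    (map_eq_zero_iff (lieCoords p (K := K)) (lieCoords_injective p)).symm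
  constructor
  · rintro h ⟨x, hx⟩
    refine ⟨⟨redOrder p K, mem_nonZeroDivisors_of_ne_zero
      (Nat.cast_ne_zero.mpr (redOrder_ne_zero p K))⟩, Subtype.ext ?_⟩
    change (redOrder p K : ℤ_[p]) • x = 0
    rw [Nat.cast_smul_eq_nsmul]
    exact h _ (lTensor_unitReduction_redOrder_smul_eq_zero p ((hker x).mp hx))
  · intro h x hx
    obtain ⟨c, hc⟩ := h (x := ⟨x, (hker x).mpr (tensorLogCoords_eq_zero p hx)⟩)
    obtain ⟨j, hj⟩ := PadicInt.exists_pow_smul_eq_zero_of_smul_eq_zero p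
      (nonZeroDivisors.coe_ne_zero c) (congrArg Subtype.val hc)
    exact eq_zero_of_torsion p hj (hx 2)

end Leopoldt

/-! ### The dimension of the closure of the unit group -/

section dimension

variable (p : ℕ) [hp : Fact p.Prime] (K : Type*) [Field K] [NumberField K]

/-- The image of the logarithm is compact, being generated by finitely many elements over the
compact ring `ℤ_p`. -/
lemma isCompact_range_tensorLog :
    IsCompact (LinearMap.range (tensorLog p K) : Set (AlgGroup.LieAlg (ResGm ℚ K) p)) := by
  obtain ⟨n, f, hf⟩ := Module.Finite.exists_fin' ℤ_[p] (ℤ_[p] ⊗[ℤ] Additive (𝓞 K)ˣ)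
  have hrange : (LinearMap.range (tensorLog p K) : Set (AlgGroup.LieAlg (ResGm ℚ K) p)) =
      Set.range (tensorLog p K ∘ₗ f) := by
    rw [LinearMap.coe_range, LinearMap.coe_comp, hf.range_comp]
  rw [hrange]
  refine isCompact_range (Continuous.subtype_mk (continuous_pi fun a => ?_) _)
  have h : ∀ v, ((tensorLog p K ∘ₗ f) v : ResGm ℚ K → ℚ_[p]) a =
      ∑ i, (v i : ℚ_[p]) * ((tensorLog p K ∘ₗ f) (Pi.single i 1) : ResGm ℚ K → ℚ_[p]) a := by
    intro v
    conv_lhs => rw [← LinearMap.sum_single_apply (fun _ => ℤ_[p]) v, map_sum]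
    rw [AddSubmonoidClass.coe_finsetSum, Finset.sum_apply]
    refine Finset.sum_congr rfl fun i _ => ?_
    have : (Pi.single i (v i) : Fin n → ℤ_[p]) = v i • Pi.single i 1 := by
      rw [← Pi.single_smul, smul_eq_mul, mul_one]
    rw [this, map_smul]
    rfl
  change Continuous fun v => ((tensorLog p K ∘ₗ f) v : ResGm ℚ K → ℚ_[p]) a
  refine (continuous_congr h).mpr (continuous_finsetSum _ fun i _ => ?_)
  exact (continuous_subtype_val.comp (continuous_apply i)).mul continuous_const

lemma span_closure_logSet :
    Submodule.span ℤ_[p] (closure (AlgGroup.logSet p (unitSubgroup K))) =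
      LinearMap.range (tensorLog p K) := by
  rw [logSet_unitSubgroup]
  refine le_antisymm (Submodule.span_le.mpr ?_) ?_
  · refine closure_minimal ?_ (isCompact_range_tensorLog p K).isClosed
    rintro _ ⟨u, rfl⟩
    exact ⟨1 ⊗ₜ u, by rw [tensorLog, LinearMap.liftBaseChange_tmul, one_smul]⟩
  · rintro _ ⟨x, rfl⟩
    induction x with
    | zero => rw [map_zero]; exact zero_mem _
    | tmul c u =>
      rw [tensorLog, LinearMap.liftBaseChange_tmul]
      exact Submodule.smul_mem _ _ (Submodule.subset_span (subset_closure ⟨u, rfl⟩))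
    | add x y hx hy => rw [map_add]; exact add_mem hx hy

lemma rk_unitSubgroup :
    AlgGroup.rk (unitSubgroup K) = Module.finrank ℤ (Additive (𝓞 K)ˣ) := by
  rw [← range_unitPoint]
  exact (MonoidHom.ofInjective unitPoint_injective).toAdditive.toIntLinearEquiv.finrank_eq.symm

/-- Rank-nullity for the logarithm on `ℤ_p ⊗ 𝓞_K^×`. -/
lemma dimClosure_add_finrank_ker :
    AlgGroup.dimClosure p (unitSubgroup K) +
      Module.finrank ℤ_[p] (LinearMap.ker (tensorLog p K)) = AlgGroup.rk (unitSubgroup K) := by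
  rw [AlgGroup.dimClosure, span_closure_logSet, rk_unitSubgroup,
    ← (TensorProduct.isBaseChange ℤ (Additive (𝓞 K)ˣ) ℤ_[p]).finrank_eq,
    ← (LinearMap.ker (tensorLog p K)).finrank_quotient_add_finrank,
    (tensorLog p K).quotKerEquivRange.finrank_eq]

lemma leopoldtConjecture_iff_dimClosure_eq :
    LeopoldtConjecture K p ↔
      AlgGroup.dimClosure p (unitSubgroup K) = AlgGroup.rk (unitSubgroup K) := by
  rw [leopoldtConjecture_iff, ← Module.finrank_eq_zero_iff_isTorsion,
    ← dimClosure_add_finrank_ker p K]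
  omega

end dimension

/-! ### Compactness of the closure of the unit group -/

namespace AlgGroup

variable {A : Type*} [CommRing A] [HopfAlgebra ℚ A] {p : ℕ} [Fact p.Prime]

lemma continuous_eval (a : A) : Continuous fun g : Points A ℚ_[p] => g.ofConv a :=
  (continuous_apply a).comp continuous_induced_dom

lemma continuous_points_iff {X : Type*} [TopologicalSpace X] {f : X → Points A ℚ_[p]} :
    Continuous f ↔ ∀ a, Continuous fun x => (f x).ofConv a := by
  rw [continuous_induced_rng, continuous_pi_iff]
  rfl

instance instIsTopologicalGroup : IsTopologicalGroup (Points A ℚ_[p]) where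
  continuous_mul := by
    refine continuous_points_iff.mpr fun a => ?_
    have h : ∀ t : A ⊗[ℚ] A, Continuous fun x : Points A ℚ_[p] × Points A ℚ_[p] =>
        Algebra.TensorProduct.lift x.1.ofConv x.2.ofConv (fun _ _ => Commute.all _ _) t := by
      intro t
      induction t with
      | zero => simpa using continuous_const
      | tmul a b =>
        simp only [Algebra.TensorProduct.lift_tmul]
        exact ((continuous_eval a).comp continuous_fst).mul
          ((continuous_eval b).comp continuous_snd)
      | add s t hs ht =>
        simp only [map_add]
        exact hs.add ht
    refine (continuous_congr fun x => ?_).mpr (h (Coalgebra.comul a))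
    exact AlgHom.convMul_apply _ _ a
  continuous_inv := continuous_points_iff.mpr fun a => continuous_eval (HopfAlgebra.antipode ℚ a)

lemma isClosedEmbedding_eval :
    Topology.IsClosedEmbedding fun (g : Points A ℚ_[p]) (a : A) => g.ofConv a := by
  refine ⟨⟨⟨rfl⟩, fun g h hgh => ofConv_injective (AlgHom.ext fun a => congrFun hgh a)⟩, ?_⟩
  have hrange : (Set.range fun (g : Points A ℚ_[p]) (a : A) => g.ofConv a) =
      {f | (∀ q : ℚ, f (algebraMap ℚ A q) = algebraMap ℚ ℚ_[p] q) ∧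
        (∀ a b, f (a + b) = f a + f b) ∧ ∀ a b, f (a * b) = f a * f b} := by
    ext f
    constructor
    · rintro ⟨g, rfl⟩
      exact ⟨fun q => g.ofConv.commutes q, fun a b => map_add _ a b, fun a b => map_mul _ a b⟩
    · rintro ⟨h1, h2, h3⟩
      exact ⟨toConv { toFun := f
                      map_one' := by simpa using h1 1
                      map_mul' := h3
                      map_zero' := by simpa using h1 0
                      map_add' := h2
                      commutes' := h1 }, rfl⟩
  rw [hrange]
  simp only [Set.ofPred_and, Set.ofPred_forall]
  refine IsClosed.inter (isClosed_iInter fun q => isClosed_eq (continuous_apply _) continuous_const)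
    (IsClosed.inter ?_ ?_)
  · exact isClosed_iInter fun a => isClosed_iInter fun b => isClosed_eq (continuous_apply _)
      ((continuous_apply a).add (continuous_apply b))
  · exact isClosed_iInter fun a => isClosed_iInter fun b => isClosed_eq (continuous_apply _)
      ((continuous_apply a).mul (continuous_apply b))

/-- A subgroup on which generators of the coordinate ring are bounded has compact closure. -/
lemma mem_compactPart_of_bounded (Γ : Subgroup (Points A ℚ_[p])) {s : Set A}
    (hs : Algebra.adjoin ℚ s = ⊤) (h : ∀ a ∈ s, ∃ r : ℝ, ∀ g ∈ Γ, ‖g.ofConv a‖ ≤ r)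
    {g : Points A ℚ_[p]} (hg : g ∈ Γ) : g ∈ compactPart A p := by
  have hbdd : ∀ a : A, ∃ r : ℝ, ∀ g ∈ Γ, ‖g.ofConv a‖ ≤ r := by
    intro a
    have ha : a ∈ Algebra.adjoin ℚ s := hs ▸ Algebra.mem_top
    induction ha using Algebra.adjoin_induction with
    | mem a ha => exact h a ha
    | algebraMap q =>
      exact ⟨‖algebraMap ℚ ℚ_[p] q‖, fun g _ => by rw [AlgHom.commutes]⟩
    | add a b _ _ ha hb =>
      obtain ⟨r, hr⟩ := ha
      obtain ⟨t, ht⟩ := hb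
      refine ⟨r + t, fun g hg => ?_⟩
      rw [map_add]
      exact (norm_add_le _ _).trans (add_le_add (hr g hg) (ht g hg))
    | mul a b _ _ ha hb =>
      obtain ⟨r, hr⟩ := ha
      obtain ⟨t, ht⟩ := hb
      refine ⟨r * t, fun g hg => ?_⟩
      rw [map_mul, norm_mul]
      exact mul_le_mul (hr g hg) (ht g hg) (norm_nonneg _) ((norm_nonneg _).trans (hr g hg))
  choose r hr using hbdd
  refine ⟨Γ.topologicalClosure, ?_, Γ.le_topologicalClosure hg⟩
  have hcomp : IsCompact (Set.univ.pi fun a : A => Metric.closedBall (0 : ℚ_[p]) (r a)) :=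
    isCompact_univ_pi fun a => isCompact_closedBall _ _
  refine (isClosedEmbedding_eval.isCompact_preimage hcomp).of_isClosed_subset
    Γ.isClosed_topologicalClosure ?_
  refine closure_minimal (fun g hg a _ => ?_)
    (hcomp.isClosed.preimage isClosedEmbedding_eval.continuous)
  rw [mem_closedBall_zero_iff]
  exact hr a g hg

end AlgGroup

section compact

variable (p : ℕ) [hp : Fact p.Prime] {K : Type*} [Field K] [NumberField K]

/-- The coordinates of algebraic integers in a basis of `K` are `p`-adically bounded. -/
lemma exists_norm_repr_coe_le (j : Fin (Module.finrank ℚ K)) :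
    ∃ r : ℝ, ∀ x : 𝓞 K, ‖(((Module.finBasis ℚ K).repr (x : K) j : ℚ) : ℚ_[p])‖ ≤ r := by
  refine ⟨∑ i, ‖(((Module.finBasis ℚ K).repr (NumberField.integralBasis K i) j : ℚ) : ℚ_[p])‖,
    fun x => ?_⟩
  rw [Module.Basis.repr_eq_sum (NumberField.integralBasis K)]
  push_cast
  refine (norm_sum_le _ _).trans (Finset.sum_le_sum fun i _ => ?_)
  rw [norm_mul]
  refine mul_le_of_le_one_left (norm_nonneg _) ?_
  exact (norm_le_pi_norm (padicCoords p (x : K)) i).trans (norm_padicCoords_coe_le_one p x)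

lemma toPadic_mem_compactPart {g : AlgGroup.Points (ResGm ℚ K) ℚ} (hg : g ∈ unitSubgroup K) :
    AlgGroup.toPadic p g ∈ AlgGroup.compactPart (ResGm ℚ K) p := by
  refine AlgGroup.mem_compactPart_of_bounded ((unitSubgroup K).map (AlgGroup.toPadic p))
    ResGm.adjoin_coords ?_ ⟨g, hg, rfl⟩
  have heval : ∀ (u : (𝓞 K)ˣ) (a : ResGm ℚ K), (AlgGroup.toPadic p (unitPoint K u)).ofConv a =
      (((unitPoint K u).ofConv a : ℚ) : ℚ_[p]) := fun u a => eq_ratCast (algebraMap ℚ ℚ_[p]) _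
  rintro _ (⟨j, rfl⟩ | ⟨j, rfl⟩) <;> obtain ⟨r, hr⟩ := exists_norm_repr_coe_le p j <;>
    refine ⟨r, ?_⟩ <;> rintro _ ⟨g, hg, rfl⟩ <;> rw [← range_unitPoint] at hg <;>
    obtain ⟨u, rfl⟩ := hg <;> rw [heval]
  · rw [unitPoint_coordX]
    exact hr u
  · rw [unitPoint_coordY]
    exact hr (u⁻¹ : (𝓞 K)ˣ)

end compact

end

theorem mainTheorem1 (K : Type*) [Field K] [NumberField K] (p : ℕ) [Fact p.Prime] :
    (unitSubgroup K).FG ∧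
    (∀ g ∈ unitSubgroup K, AlgGroup.toPadic p g ∈ AlgGroup.compactPart (ResGm ℚ K) p) ∧
    AlgGroup.d (unitSubgroup K) = AlgGroup.rk (unitSubgroup K) ∧
    (LeopoldtConjecture K p ↔
      AlgGroup.dimClosure p (unitSubgroup K) = AlgGroup.d (unitSubgroup K)) :=
  ⟨unitSubgroup_fg, fun _ hg => toPadic_mem_compactPart p hg, d_unitSubgroup, by
    rw [d_unitSubgroup]
    exact leopoldtConjecture_iff_dimClosure_eq p K⟩
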